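/- Let $q$ be a prime power, let $a\in\mathrm{GF}(q^2)$ be non-zero and let $b\in\mathrm{GF}(q^2)\setminus\mathrm{GF}(q)$. Assume that $(a,b)$ satisfies Ebert's discriminant condition: for odd $q$, $4a^{q+1}+(b^q-b)^2$ is a non-square in $\mathrm{GF}(q)$; for even $q$, $\mathrm{Tr}\bigl(a^{q+1}/(b^q+b)^2\bigr)=0$, where $\mathrm{Tr}$ is the trace map $\mathrm{GF}(q)\to\mathrm{GF}(2)$. Let $\mathfrak A_a$ be the affine plane whose points are the points $(x,y)$ of $\mathrm{AG}(2,q^2)$ and whose lines are the vertical lines $x=k$ together with the parabolas $y=ax^2+mx+d$ $(k,m,d\in\mathrm{GF}(q^2))$. Let $\mathcal H$ be the set of the points $(x,y)$ with $y^q-y+(b-b^q)x^{q+1}=0$, and let $Y_\infty$ be the common point at infinity of the vertical lines. Then the map $(x,y)\mapsto(1,x,y-ax^2)$ extends to an isomorphism from the projective closure of $\mathfrak A_a$ onto $\mathrm{PG}(2,q^2)$. Under this identification with $\mathrm{PG}(2,q^2)$, the point set $\mathcal H\cup\{Y_\infty\}$ is a Buekenhout–Metz (B-M) unital which is not of Hirschfeld–Szőnyi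 (H-Sz) type. Here a unital is a set of $q^3+1$ points that meets every line in $1$ or $q+1$ points. A unital of $\mathrm{PG}(2,q^2)$ is a B-M unital if, for some line $\ell_\infty$ and the corresponding Bruck–Bose representation of $\mathrm{PG}(2,q^2)$ in $\mathrm{PG}(4,q)$ by a regular spread of a hyperplane $\Sigma_\infty$, it is represented by a cone over an elliptic quadric of a hyperplane not passing through the vertex of the cone, where the vertex lies on a spread line and the cone meets $\Sigma_\infty$ exactly in that spread line. (Classical unitals are thus included among the B-M unitals.) A B-M unital is of H-Sz type if it is the union of $q$ non-degenerate conics with a common point. -/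

import Mathlib

open scoped LinearAlgebra.Projectivization

noncomputable section

namespace NonStandardUnital

/-! ## Incidence structures whose lines are sets of points -/

structure IncidenceStructure (P : Type*) where
  lines : Set (Set P)

/-- Isomorphisms: bijections of the points such that a point set is a line exactly if its image
is one. -/
structure IncidenceIso {P P' : Type*} (A : IncidenceStructure P) (B : IncidenceStructure P') where
  toEquiv : P ≃ P'
  mem_lines_iff : ∀ s : Set P, s ∈ A.lines ↔ toEquiv '' s ∈ B.lines

/-- Two lines of an affine plane are parallel if they are equal or have no common point. -/
def Parallel {P : Type*} (l m : Set P) : Prop := l = m ∨ Disjoint l m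

/-- The set of all lines of `A` parallel to `l`. -/
def parallelClass {P : Type*} (A : IncidenceStructure P) (l : Set P) : Set (Set P) :=
  {m | m ∈ A.lines ∧ Parallel l m}

/-- The points at infinity of an affine plane: its parallel classes of lines. -/
def InfinitePoint {P : Type*} (A : IncidenceStructure P) : Type _ :=
  {c : Set (Set P) // ∃ l ∈ A.lines, c = parallelClass A l}

/-- The point at infinity of a line. -/
def infinitePoint {P : Type*} (A : IncidenceStructure P) (l : Set P) (hl : l ∈ A.lines) :
    InfinitePoint A :=
  ⟨parallelClass A l, l, hl, rfl⟩

/-- The projective closure of an affine plane: every line gets its point at infinity, and the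
points at infinity form a further line. -/
def projectiveClosure {P : Type*} (A : IncidenceStructure P) :
    IncidenceStructure (P ⊕ InfinitePoint A) where
  lines := {s | (∃ (l : Set P) (hl : l ∈ A.lines),
      s = insert (Sum.inr (infinitePoint A l hl)) (Sum.inl '' l)) ∨ s = Set.range Sum.inr}

/-! ## The projective plane over a field -/

/-- The points of the projective plane over `K`, with homogeneous coordinates. -/
abbrev PGPoint (K : Type*) [Field K] : Type _ := ℙ K (Fin 3 → K)

/-- The projective plane over `K`: the lines are the two-dimensional subspaces of `K³`. -/
def PG2 (K : Type*) [Field K] : IncidenceStructure (PGPoint K) where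
  lines := {s | ∃ W : Submodule K (Fin 3 → K), Module.finrank K W = 2 ∧
    s = {p : PGPoint K | p.submodule ≤ W}}

/-- The point with homogeneous coordinates `(1, x, y)`. -/
def affinePoint {K : Type*} [Field K] (x y : K) : PGPoint K :=
  Projectivization.mk K ![1, x, y] (fun h => one_ne_zero (congrFun h 0))

/-- The projectivity induced by an invertible linear map. -/
def projectivity {K : Type*} [Field K] (g : (Fin 3 → K) ≃ₗ[K] (Fin 3 → K)) :
    PGPoint K → PGPoint K :=
  Projectivization.map g.toLinearMap g.injective

/-- A unital of a projective plane of order `q²`: a set of `q³ + 1` points that meets every line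
in `1` or `q + 1` points. -/
def IsUnital {P : Type*} (A : IncidenceStructure P) (q : ℕ) (U : Set P) : Prop :=
  U.ncard = q ^ 3 + 1 ∧ ∀ l ∈ A.lines, (U ∩ l).ncard = 1 ∨ (U ∩ l).ncard = q + 1

/-- A non-degenerate conic: the zero set of a ternary quadratic form without singular points. -/
def IsConic {K : Type*} [Field K] (C : Set (PGPoint K)) : Prop :=
  ∃ Q : QuadraticForm K (Fin 3 → K),
    (∀ v, v ≠ 0 → Q v = 0 → ∃ w, QuadraticMap.polar Q v w ≠ 0) ∧
    C = {p : PGPoint K | Q p.rep = 0}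

/-! ## Bruck-Bose representation and Buekenhout-Metz unitals

Here `F` is the field with `q` elements and `K` its quadratic extension. The five-dimensional
`F`-space `F × K × K` is the vector space of `PG(4, q)`, the hyperplane at infinity consists of
the vectors `(0, x, y)`, and the vector `(1, x, y)` represents the point `(1, x, y)` of
`PG(2, q²)`. -/

/-- A quadratic form that defines an elliptic quadric of a three-dimensional projective space:
it is a non-degenerate form in four variables, and no line lies on the quadric. -/
def IsElliptic {F M : Type*} [Field F] [AddCommGroup M] [Module F M]
    (Q : QuadraticForm F M) : Prop :=
  Module.finrank F M = 4 ∧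
  (∀ x, (∀ y, QuadraticMap.polar Q x y = 0) → x = 0) ∧
  ∀ S : Submodule F M, (∀ x ∈ S, Q x = 0) → Module.finrank F S ≤ 1

section BruckBose

variable {F K : Type*} [Field F] [Field K] [Algebra F K]

/-- The cone with vertex `⟨v⟩` over the quadric `Q = 0` of the hyperplane `H`, as a set of
vectors. -/
def quadricCone (v : F × K × K) (H : Submodule F (F × K × K)) (Q : QuadraticForm F H) :
    Set (F × K × K) :=
  {m | ∃ (c : F) (h : H), Q h = 0 ∧ m = c • v + (h : F × K × K)}

/-- The line of the regular spread that represents the point `(0, w₁, w₂)` at infinity of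
`PG(2, q²)`, as a set of vectors. -/
def spreadLine (F : Type*) {K : Type*} [Field F] [Field K] (w : K × K) : Set (F × K × K) :=
  {m | m.1 = 0 ∧ ∃ c : K, m.2 = c • w}

/-- The point set of `PG(2, q²)` represented by a subset of `PG(4, q)` which meets the
hyperplane at infinity in the spread line given by `w`. -/
def representedSet (T : Set (F × K × K)) (w : K × K) : Set (PGPoint K) :=
  {p | (∃ x y : K, ((1 : F), x, y) ∈ T ∧ p = affinePoint x y) ∨
    ∃ h : ![0, w.1, w.2] ≠ 0, p = Projectivization.mk K ![0, w.1, w.2] h}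

/-- Buekenhout-Metz unitals: up to a projectivity that moves the line at infinity to `x₀ = 0`,
the unital is represented by the cone over an elliptic quadric with vertex on a spread line,
where the cone meets the hyperplane at infinity exactly in that spread line. -/
def IsBMUnital (F : Type*) {K : Type*} [Field F] [Fintype F] [Field K] [Algebra F K]
    (U : Set (PGPoint K)) : Prop :=
  IsUnital (PG2 K) (Fintype.card F) U ∧
  ∃ (g : (Fin 3 → K) ≃ₗ[K] (Fin 3 → K)) (w : K × K) (v : F × K × K)
    (H : Submodule F (F × K × K)) (Q : QuadraticForm F H),
    w ≠ 0 ∧ v ≠ 0 ∧ v ∈ spreadLine F w ∧ IsCompl (F ∙ v) H ∧ IsElliptic Q ∧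
    {m | m ∈ quadricCone v H Q ∧ m.1 = 0} = spreadLine F w ∧
    projectivity g '' U = representedSet (quadricCone v H Q) w

/-- Buekenhout-Metz unitals of Hirschfeld-Szonyi type: those that are the union of `q` conics
with a common point. -/
def IsHSzUnital (F : Type*) {K : Type*} [Field F] [Fintype F] [Field K] [Algebra F K]
    (U : Set (PGPoint K)) : Prop :=
  IsBMUnital F U ∧
  ∃ (P : PGPoint K) (C : Fin (Fintype.card F) → Set (PGPoint K)),
    (∀ i, IsConic (C i) ∧ P ∈ C i) ∧ U = ⋃ i, C i

/-- Ebert's discriminant condition on `(a, b)`. For even `q = 2 ^ e` the sum is the absolute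
trace of `d = a ^ (q + 1) / (b ^ q + b) ^ 2`. -/
def EbertCondition (F : Type*) {K : Type*} [Field F] [Fintype F] [Field K] [Algebra F K]
    (a b : K) : Prop :=
  let q := Fintype.card F
  (Odd q → ∃ d : F, algebraMap F K d = 4 * a ^ (q + 1) + (b ^ q - b) ^ 2 ∧ ¬ IsSquare d) ∧
  (Even q → b ∉ Set.range (algebraMap F K) ∧
    ∃ (e : ℕ) (d : F), q = 2 ^ e ∧
      algebraMap F K d = a ^ (q + 1) / (b ^ q + b) ^ 2 ∧
      ∑ i ∈ Finset.range e, d ^ (2 ^ i) = 0)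

end BruckBose

/-! ## The affine plane of vertical lines and parabolas -/

section Model

variable {K : Type*} [Field K]

/-- The vertical line `x = k`. -/
def verticalLine (k : K) : Set (K × K) := {p | p.1 = k}

/-- The parabola `y = a x² + m x + d`. -/
def parabola (a m d : K) : Set (K × K) := {p | p.2 = a * p.1 ^ 2 + m * p.1 + d}

/-- The plane whose lines are the vertical lines and the parabolas with leading coefficient
`a`. -/
def parabolaPlane (a : K) : IncidenceStructure (K × K) where
  lines := {s | (∃ k, s = verticalLine k) ∨ ∃ m d, s = parabola a m d}

/-- The common point at infinity of the vertical lines. -/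
def yInfinity (a : K) : InfinitePoint (parabolaPlane a) :=
  infinitePoint (parabolaPlane a) (verticalLine 0) (Or.inl ⟨0, rfl⟩)

/-- The affine points of the Hermitian curve `y ^ q - y + (b - b ^ q) x ^ (q + 1) = 0`. -/
def hermitianCurve (q : ℕ) (b : K) : Set (K × K) :=
  {p | p.2 ^ q - p.2 + (b - b ^ q) * p.1 ^ (q + 1) = 0}

/-- The affine points of the Hermitian curve together with the point at infinity of the vertical
lines, as points of the projective closure of the plane of parabolas. -/
def completedCurve (q : ℕ) (a b : K) : Set ((K × K) ⊕ InfinitePoint (parabolaPlane a)) :=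
  insert (Sum.inr (yInfinity a)) (Sum.inl '' hermitianCurve q b)

end Model

end NonStandardUnital

end

/-!
The map `(x, y) ↦ (1, x, y - a x ²)` straightens the parabolas `y = a x ² + m x + d` to the lines
`y = m x + d`. The parallel classes of the plane of parabolas are the class of the vertical lines
and one class for each `m`, and they are sent to `(0, 0, 1)` and `(0, 1, m)` (`straightenIso`).

The curve becomes the set of the points `(1, x, y)` with `y + a x ² - b x ^ (q + 1)` in `F`. Put
`δ = b ^ q - b`. Ebert's condition, uniformly in `q`, says that there are distinct `s`, `t` in `F`
with sum `1` and product `-a ^ (q + 1) / δ ^ 2`: for odd `q` the discriminant of the quadratic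
equation is the quotient of two non-squares, and for even `q` the trace condition makes
`t ² + t = d` solvable (`exists_roots_of_ebertCondition`). Elements `α`, `β` of `K` with norms `s`,
`t` and `δ α β ^ q = a` bring the equation into the form
`y ^ q - y = δ N(α x + β x ^ q)`, where `N` is the norm and `x ↦ α x + β x ^ q` is a bijection which
is linear over `F` (`IsNormalization`). On a line `y = m x + d` this amounts to an equation
`N(z) = k` with `k` in `F`, which has `1` or `q + 1` solutions; so the curve is a unital
(`isUnital_ebertSet`). The left side and the right side of the equation, homogenized by
`t ∈ F` to `t (y ^ q - y) / δ - N(α x + β x ^ q)`, give a quadratic form on `F × K × K` with radical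
`⟨(0, 0, 1)⟩` and elliptic on every complement of the radical, and its zeros form the required cone
(`isBMUnital_ebertSet`).

The curve does not even contain a single conic. A parametrization of a conic by quadratic
polynomials turns the equation of the curve, which has degree `2 q`, into a polynomial of degree at
most `4 q` with a zero at each of the `q ² + 1` points of the projective line. The condition forces
`q ≥ 4` (`four_le_card`), so the equation holds identically. If the conic has no point at infinity,
its first coordinate is irreducible and divides the second coordinate, which puts the conic into a
line. Otherwise it has only the point `(0, 0, 1)` at infinity, so it is a parabola
`y = r x ² + m x + d`, and the coefficient of `x ^ (q + 1)` in the equation would have to be `0`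
instead of a nonzero multiple of `δ` (`not_isConic_subset_ebertSet`).
-/

open scoped LinearAlgebra.Projectivization

noncomputable section

namespace NonStandardUnital

/-! ### Lines and points of the projective plane in coordinates -/

section Lines

variable {K : Type*} [Field K]

/-- The points of the projective plane whose coordinates satisfy the linear equation with
coefficient vector `c`. It is a line exactly if `c ≠ 0`. -/
def coordLine (c : Fin 3 → K) : Set (PGPoint K) := {p | c ⬝ᵥ p.rep = 0}

theorem mk_mem_coordLine (c v : Fin 3 → K) (hv : v ≠ 0) :
    Projectivization.mk K v hv ∈ coordLine c ↔ c ⬝ᵥ v = 0 := by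
  obtain ⟨k, hk⟩ := Projectivization.exists_smul_eq_mk_rep K v hv
  simp only [coordLine, Set.mem_ofPred_eq, ← hk, Units.smul_def, dotProduct_smul, smul_eq_mul,
    mul_eq_zero, k.ne_zero, false_or]

theorem coordLine_smul (k : K) (hk : k ≠ 0) (c : Fin 3 → K) :
    coordLine (k • c) = coordLine c := by
  ext p
  simp [coordLine, hk]

theorem setOf_submodule_le_eq_coordLine (W : Submodule K (Fin 3 → K)) (c : Fin 3 → K)
    (h : ∀ v, v ∈ W ↔ c ⬝ᵥ v = 0) : {p : PGPoint K | p.submodule ≤ W} = coordLine c := by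
  ext p
  rw [Set.mem_ofPred_eq, Projectivization.submodule_eq, Submodule.span_singleton_le_iff_mem, h]
  rfl

theorem mem_PG2_lines_iff (s : Set (PGPoint K)) :
    s ∈ (PG2 K).lines ↔ ∃ c : Fin 3 → K, c ≠ 0 ∧ s = coordLine c := by
  constructor
  · rintro ⟨W, hW, rfl⟩
    have hlt : W < ⊤ := by
      rw [lt_top_iff_ne_top]
      rintro rfl
      simp at hW
    obtain ⟨f, hf, hWf⟩ := Submodule.exists_le_ker_of_lt_top W hlt
    have hfin := Module.Dual.finrank_ker_add_one_of_ne_zero hf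
    have hW' : W = LinearMap.ker f := by
      apply Submodule.eq_of_le_of_finrank_eq hWf
      simp at hfin
      omega
    have hfc : ∀ v, f v = (fun i => f (Pi.single i 1)) ⬝ᵥ v := by
      intro v
      conv_lhs => rw [← Finset.univ_sum_single v, map_sum]
      refine Finset.sum_congr rfl fun i _ => ?_
      rw [mul_comm, ← smul_eq_mul, ← map_smul, ← Pi.single_smul, smul_eq_mul, mul_one]
    refine ⟨fun i => f (Pi.single i 1), ?_, ?_⟩
    · intro h
      apply hf
      ext v
      simpa using congrFun h v
    · apply setOf_submodule_le_eq_coordLine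
      intro v
      rw [hW', LinearMap.mem_ker, hfc]
  · rintro ⟨c, hc, rfl⟩
    have hf : (dotProductBilin K K c : Module.Dual K (Fin 3 → K)) ≠ 0 := by
      intro h
      apply hc
      ext i
      simpa using LinearMap.congr_fun h (Pi.single i 1)
    have hfin := Module.Dual.finrank_ker_add_one_of_ne_zero hf
    refine ⟨LinearMap.ker (dotProductBilin K K c : Module.Dual K (Fin 3 → K)), ?_, ?_⟩
    · simp at hfin
      omega
    · symm
      apply setOf_submodule_le_eq_coordLine
      intro v
      simp

/-- The lines of the projective plane are the oblique lines `y = m x + d`, the vertical lines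
`x = k` and the line at infinity. -/
theorem mem_PG2_lines_iff_normal_form (s : Set (PGPoint K)) :
    s ∈ (PG2 K).lines ↔ (∃ m d : K, s = coordLine ![-d, -m, 1]) ∨
      (∃ k : K, s = coordLine ![-k, 1, 0]) ∨ s = coordLine ![1, 0, 0] := by
  rw [mem_PG2_lines_iff]
  constructor
  · rintro ⟨c, hc, rfl⟩
    by_cases h2 : c 2 = 0
    · right
      by_cases h1 : c 1 = 0
      · right
        have h0 : c 0 ≠ 0 := by
          intro h0
          apply hc
          ext i
          fin_cases i <;> simp [h0, h1, h2]
        rw [← coordLine_smul (c 0) h0 ![_, _, _]]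
        congr 1
        ext i
        fin_cases i <;> simp [h1, h2]
      · left
        refine ⟨-(c 0 / c 1), ?_⟩
        rw [← coordLine_smul (c 1) h1 ![_, _, _]]
        congr 1
        ext i
        fin_cases i <;> simp [h2]
        field_simp
    · left
      refine ⟨-(c 1 / c 2), -(c 0 / c 2), ?_⟩
      rw [← coordLine_smul (c 2) h2 ![_, _, _]]
      congr 1
      ext i
      fin_cases i <;> simp <;> field_simp
  · rintro (⟨m, d, rfl⟩ | ⟨k, rfl⟩ | rfl)
    · exact ⟨_, fun h => by simpa using congrFun h 2, rfl⟩
    · exact ⟨_, fun h => by simpa using congrFun h 1, rfl⟩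
    · exact ⟨_, fun h => by simpa using congrFun h 0, rfl⟩

theorem affinePoint_mem_coordLine (c : Fin 3 → K) (x y : K) :
    affinePoint x y ∈ coordLine c ↔ c 0 + c 1 * x + c 2 * y = 0 := by
  rw [affinePoint, mk_mem_coordLine]
  simp [dotProduct, Fin.sum_univ_three]

theorem affinePoint_inj {x y x' y' : K} (h : affinePoint x y = affinePoint x' y') :
    x = x' ∧ y = y' := by
  rw [affinePoint, affinePoint, Projectivization.mk_eq_mk_iff'] at h
  obtain ⟨k, hk⟩ := h
  have h0 := congrFun hk 0
  have h1 := congrFun hk 1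
  have h2 := congrFun hk 2
  simp at h0 h1 h2
  subst h0
  simp_all

/-- The points `(0, 0, 1)` (for `none`) and `(0, 1, m)` (for `some m`) of the line at infinity. -/
def pointAtInfinity : Option K → PGPoint K
  | none => Projectivization.mk K ![0, 0, 1] (fun h => one_ne_zero (congrFun h 2))
  | some m => Projectivization.mk K ![0, 1, m] (fun h => one_ne_zero (congrFun h 1))

theorem pointAtInfinity_none_mem_coordLine (c : Fin 3 → K) :
    pointAtInfinity none ∈ coordLine c ↔ c 2 = 0 := by
  rw [pointAtInfinity, mk_mem_coordLine]
  simp [dotProduct, Fin.sum_univ_three]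

theorem pointAtInfinity_some_mem_coordLine (c : Fin 3 → K) (m : K) :
    pointAtInfinity (some m) ∈ coordLine c ↔ c 1 + c 2 * m = 0 := by
  rw [pointAtInfinity, mk_mem_coordLine]
  simp [dotProduct, Fin.sum_univ_three]

theorem pointAtInfinity_injective : Function.Injective (pointAtInfinity (K := K)) := by
  rintro (_ | m) (_ | m') h
  · rfl
  · have := pointAtInfinity_none_mem_coordLine ![0, -m', 1]
    rw [h, pointAtInfinity_some_mem_coordLine] at this
    simp at this
  · have := pointAtInfinity_none_mem_coordLine ![0, -m, 1]
    rw [← h, pointAtInfinity_some_mem_coordLine] at this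
    simp at this
  · have := pointAtInfinity_some_mem_coordLine ![0, -m', 1] m
    rw [h, pointAtInfinity_some_mem_coordLine] at this
    simp at this
    rw [eq_of_sub_eq_zero (by rw [← this]; ring : m - m' = 0)]

theorem affinePoint_ne_pointAtInfinity (x y : K) (o : Option K) :
    affinePoint x y ≠ pointAtInfinity o := by
  intro h
  have h1 := affinePoint_mem_coordLine ![1, 0, 0] x y
  rw [h] at h1
  cases o with
  | none => rw [pointAtInfinity_none_mem_coordLine] at h1; simp at h1
  | some m => rw [pointAtInfinity_some_mem_coordLine] at h1; simp at h1

theorem affinePoint_or_pointAtInfinity (p : PGPoint K) :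
    (∃ x y, p = affinePoint x y) ∨ ∃ o, p = pointAtInfinity o := by
  induction p using Projectivization.ind with | h v hv => ?_
  by_cases h0 : v 0 = 0
  · right
    by_cases h1 : v 1 = 0
    · refine ⟨none, (Projectivization.mk_eq_mk_iff' ..).2 ⟨v 2, ?_⟩⟩
      ext i
      fin_cases i <;> simp [h0, h1]
    · refine ⟨some (v 2 / v 1), (Projectivization.mk_eq_mk_iff' ..).2 ⟨v 1, ?_⟩⟩
      ext i
      fin_cases i <;> simp [h0]
      field_simp
  · left
    refine ⟨v 1 / v 0, v 2 / v 0, (Projectivization.mk_eq_mk_iff' ..).2 ⟨v 0, ?_⟩⟩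
    ext i
    fin_cases i <;> simp <;> field_simp

end Lines

/-! ### The closed plane of parabolas -/

section ParabolaPlane

variable {K : Type*} [Field K]

theorem parallel_vertical_vertical {K : Type*} (k k' : K) :
    Parallel (verticalLine k) (verticalLine k') := by
  by_cases h : k = k'
  · exact Or.inl (h ▸ rfl)
  · refine Or.inr (Set.disjoint_left.2 fun p hp hp' => h ?_)
    exact (show p.1 = k from hp) ▸ hp'

theorem parallel_comm {P : Type*} {l m : Set P} : Parallel l m ↔ Parallel m l := by
  rw [Parallel, Parallel, eq_comm, disjoint_comm]

theorem not_parallel_vertical_parabola (a k m d : K) :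
    ¬ Parallel (verticalLine k) (parabola a m d) := by
  rintro (h | h)
  · have h1 : (k, a * k ^ 2 + m * k + d + 1) ∈ verticalLine k := rfl
    rw [h] at h1
    simp [parabola] at h1
  · exact Set.disjoint_left.1 h (show (k, a * k ^ 2 + m * k + d) ∈ verticalLine k from rfl) rfl

theorem parallel_parabola_parabola (a m d m' d' : K) :
    Parallel (parabola a m d) (parabola a m' d') ↔ m = m' := by
  constructor
  · rintro (h | h)
    · have h0 : ((0 : K), d) ∈ parabola a m d := by simp [parabola]
      have h1 : ((1 : K), a + m + d) ∈ parabola a m d := by simp [parabola]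
      rw [h] at h0 h1
      simp only [parabola, Set.mem_ofPred_eq] at h0 h1
      linear_combination h1 - h0
    · by_contra hm
      have hm' : m - m' ≠ 0 := sub_ne_zero.2 hm
      refine Set.disjoint_left.1 h (show ((d' - d) / (m - m'),
        a * ((d' - d) / (m - m')) ^ 2 + m * ((d' - d) / (m - m')) + d) ∈ parabola a m d from rfl) ?_
      simp only [parabola, Set.mem_ofPred_eq]
      field_simp
      ring
  · rintro rfl
    by_cases h : d = d'
    · exact Or.inl (h ▸ rfl)
    · refine Or.inr (Set.disjoint_left.2 fun p hp hp' => h ?_)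
      simp only [parabola, Set.mem_ofPred_eq] at hp hp'
      linear_combination hp' - hp

theorem verticalLine_mem (a k : K) : verticalLine k ∈ (parabolaPlane a).lines := Or.inl ⟨k, rfl⟩

theorem parabola_mem (a m d : K) : parabola a m d ∈ (parabolaPlane a).lines := Or.inr ⟨m, d, rfl⟩

theorem infinitePoint_verticalLine (a k : K) :
    infinitePoint (parabolaPlane a) (verticalLine k) (verticalLine_mem a k) = yInfinity a := by
  apply Subtype.ext
  ext s
  simp only [infinitePoint, yInfinity, parallelClass, Set.mem_ofPred_eq, and_congr_right_iff]
  rintro (⟨k', rfl⟩ | ⟨m, d, rfl⟩)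
  · exact iff_of_true (parallel_vertical_vertical _ _) (parallel_vertical_vertical _ _)
  · exact iff_of_false (not_parallel_vertical_parabola _ _ _ _)
      (not_parallel_vertical_parabola _ _ _ _)

/-- The parallel class of the parabolas with linear coefficient `m`. -/
def slopeInfinity (a m : K) : InfinitePoint (parabolaPlane a) :=
  infinitePoint (parabolaPlane a) (parabola a m 0) (parabola_mem a m 0)

theorem infinitePoint_parabola (a m d : K) :
    infinitePoint (parabolaPlane a) (parabola a m d) (parabola_mem a m d) = slopeInfinity a m := by
  apply Subtype.ext
  ext s
  simp only [infinitePoint, slopeInfinity, parallelClass, Set.mem_ofPred_eq, and_congr_right_iff]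
  rintro (⟨k', rfl⟩ | ⟨m, d, rfl⟩)
  · rw [parallel_comm, parallel_comm (m := verticalLine k')]
    exact iff_of_false (not_parallel_vertical_parabola _ _ _ _)
      (not_parallel_vertical_parabola _ _ _ _)
  · rw [parallel_parabola_parabola, parallel_parabola_parabola]

theorem slopeInfinity_ne_yInfinity (a m : K) : slopeInfinity a m ≠ yInfinity a := by
  intro h
  have h1 : parabola a m 0 ∈ (slopeInfinity a m).1 := ⟨parabola_mem a m 0, Or.inl rfl⟩
  rw [h] at h1
  exact not_parallel_vertical_parabola _ _ _ _ h1.2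

theorem slopeInfinity_injective (a : K) : Function.Injective (slopeInfinity a) := by
  intro m m' h
  have h1 : parabola a m 0 ∈ (slopeInfinity a m).1 := ⟨parabola_mem a m 0, Or.inl rfl⟩
  rw [h] at h1
  exact ((parallel_parabola_parabola ..).1 h1.2).symm

/-- The points at infinity of the plane of parabolas: one for the vertical lines and one for every
linear coefficient. -/
def infinityEquiv (a : K) : Option K ≃ InfinitePoint (parabolaPlane a) :=
  Equiv.ofBijective (fun o => o.elim (yInfinity a) (slopeInfinity a)) <| by
    constructor
    · rintro (_ | m) (_ | m') h
      · rfl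
      · exact (slopeInfinity_ne_yInfinity _ _ h.symm).elim
      · exact (slopeInfinity_ne_yInfinity _ _ h).elim
      · exact congrArg some (slopeInfinity_injective a h)
    · rintro ⟨c, l, (⟨k, rfl⟩ | ⟨m, d, rfl⟩), rfl⟩
      · exact ⟨none, (infinitePoint_verticalLine a k).symm⟩
      · exact ⟨some m, (infinitePoint_parabola a m d).symm⟩

/-- The bijection from the points of the closed plane of parabolas to the projective plane which
straightens the parabolas. -/
def straightenEquiv (a : K) : (K × K) ⊕ InfinitePoint (parabolaPlane a) ≃ PGPoint K :=
  (Equiv.sumCongr (Equiv.refl _) (infinityEquiv a).symm).trans <|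
    Equiv.ofBijective
      (Sum.elim (fun p : K × K => affinePoint p.1 (p.2 - a * p.1 ^ 2)) pointAtInfinity) <| by
    constructor
    · rintro (⟨x, y⟩ | o) (⟨x', y'⟩ | o') h
      · obtain ⟨rfl, h2⟩ := affinePoint_inj h
        exact congrArg (fun z => Sum.inl (x, z)) (sub_left_injective h2)
      · exact (affinePoint_ne_pointAtInfinity _ _ _ h).elim
      · exact (affinePoint_ne_pointAtInfinity _ _ _ h.symm).elim
      · exact congrArg Sum.inr (pointAtInfinity_injective h)
    · intro p
      obtain ⟨x, y, rfl⟩ | ⟨o, rfl⟩ := affinePoint_or_pointAtInfinity p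
      · exact ⟨Sum.inl (x, y + a * x ^ 2), by simp⟩
      · exact ⟨Sum.inr o, rfl⟩

theorem straightenEquiv_inl (a x y : K) :
    straightenEquiv a (Sum.inl (x, y)) = affinePoint x (y - a * x ^ 2) := rfl

theorem straightenEquiv_inr (a : K) (o : Option K) :
    straightenEquiv a (Sum.inr (infinityEquiv a o)) = pointAtInfinity o :=
  congrArg pointAtInfinity ((infinityEquiv a).symm_apply_apply o)

theorem straightenEquiv_yInfinity (a : K) :
    straightenEquiv a (Sum.inr (yInfinity a)) = pointAtInfinity none :=
  straightenEquiv_inr a none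

theorem straightenEquiv_slopeInfinity (a m : K) :
    straightenEquiv a (Sum.inr (slopeInfinity a m)) = pointAtInfinity (some m) :=
  straightenEquiv_inr a (some m)

theorem infinitePoint_cases (a : K) (i : InfinitePoint (parabolaPlane a)) :
    i = yInfinity a ∨ ∃ m, i = slopeInfinity a m := by
  obtain ⟨_ | m, rfl⟩ := (infinityEquiv a).surjective i
  · exact Or.inl rfl
  · exact Or.inr ⟨m, rfl⟩

theorem preimage_straighten_parabola (a m d : K) :
    straightenEquiv a ⁻¹' coordLine ![-d, -m, 1] =
      insert (Sum.inr (infinitePoint _ _ (parabola_mem a m d))) (Sum.inl '' parabola a m d) := by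
  rw [infinitePoint_parabola]
  ext (⟨x, y⟩ | i)
  · rw [Set.mem_preimage, straightenEquiv_inl, affinePoint_mem_coordLine]
    simp only [parabola, Set.mem_insert_iff, reduceCtorEq, Set.mem_image, Sum.inl.injEq,
      exists_eq_right, Set.mem_ofPred_eq, false_or]
    simp
    constructor <;> intro h <;> linear_combination h
  · rw [Set.mem_preimage]
    obtain rfl | ⟨m', rfl⟩ := infinitePoint_cases a i
    · rw [straightenEquiv_yInfinity, pointAtInfinity_none_mem_coordLine]
      simp [(slopeInfinity_ne_yInfinity _ _).symm]
    · rw [straightenEquiv_slopeInfinity, pointAtInfinity_some_mem_coordLine]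
      simp [(slopeInfinity_injective a).eq_iff, neg_add_eq_zero, eq_comm]

theorem preimage_straighten_vertical (a k : K) :
    straightenEquiv a ⁻¹' coordLine ![-k, 1, 0] =
      insert (Sum.inr (infinitePoint _ _ (verticalLine_mem a k))) (Sum.inl '' verticalLine k) := by
  rw [infinitePoint_verticalLine]
  ext (⟨x, y⟩ | i)
  · rw [Set.mem_preimage, straightenEquiv_inl, affinePoint_mem_coordLine]
    simp [verticalLine, neg_add_eq_zero, eq_comm]
  · rw [Set.mem_preimage]
    obtain rfl | ⟨m', rfl⟩ := infinitePoint_cases a i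
    · rw [straightenEquiv_yInfinity, pointAtInfinity_none_mem_coordLine]
      simp
    · rw [straightenEquiv_slopeInfinity, pointAtInfinity_some_mem_coordLine]
      simp [slopeInfinity_ne_yInfinity]

theorem preimage_straighten_infinity (a : K) :
    straightenEquiv a ⁻¹' coordLine ![1, 0, 0] = Set.range Sum.inr := by
  ext (⟨x, y⟩ | i)
  · rw [Set.mem_preimage, straightenEquiv_inl, affinePoint_mem_coordLine]
    simp
  · rw [Set.mem_preimage]
    obtain rfl | ⟨m', rfl⟩ := infinitePoint_cases a i
    · rw [straightenEquiv_yInfinity, pointAtInfinity_none_mem_coordLine]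
      simp
    · rw [straightenEquiv_slopeInfinity, pointAtInfinity_some_mem_coordLine]
      simp

/-- The isomorphism from the closed plane of parabolas onto the projective plane. -/
def straightenIso (a : K) : IncidenceIso (projectiveClosure (parabolaPlane a)) (PG2 K) where
  toEquiv := straightenEquiv a
  mem_lines_iff s := by
    have himage : ∀ t : Set (PGPoint K), straightenEquiv a '' s = t ↔
        s = straightenEquiv a ⁻¹' t := fun t =>
      (Equiv.eq_preimage_iff_image_eq _ _ _).symm
    simp only [mem_PG2_lines_iff_normal_form, himage, preimage_straighten_parabola,
      preimage_straighten_vertical, preimage_straighten_infinity]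
    constructor
    · rintro (⟨l, (⟨k, rfl⟩ | ⟨m, d, rfl⟩), rfl⟩ | rfl)
      · exact Or.inr (Or.inl ⟨k, rfl⟩)
      · exact Or.inl ⟨m, d, rfl⟩
      · exact Or.inr (Or.inr rfl)
    · rintro (⟨m, d, rfl⟩ | ⟨k, rfl⟩ | rfl)
      · exact Or.inl ⟨_, parabola_mem a m d, rfl⟩
      · exact Or.inl ⟨_, verticalLine_mem a k, rfl⟩
      · exact Or.inr rfl

end ParabolaPlane

/-! ### Norms and Ebert's condition in a quadratic extension of finite fields -/

section QuadraticExtension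

variable (F : Type*) {K : Type*} [Field F] [Fintype F] [Field K] [Algebra F K]

/-- The map `x ↦ x ^ q` of an algebra over the field `F` with `q` elements. -/
def conj : K →ₐ[F] K := FiniteField.frobeniusAlgHom F K

theorem conj_apply (x : K) : conj F x = x ^ Fintype.card F := rfl

variable {F}

theorem finite_of_finrank_eq_two (hK : Module.finrank F K = 2) : Finite K :=
  have : FiniteDimensional F K := FiniteDimensional.of_finrank_pos (by omega)
  Module.finite_of_finite F

theorem natCard_eq_sq (hK : Module.finrank F K = 2) : Nat.card K = Fintype.card F ^ 2 := by
  have := finite_of_finrank_eq_two hK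
  rw [Module.natCard_eq_pow_finrank (K := F), hK, Nat.card_eq_fintype_card]

theorem conj_conj (hK : Module.finrank F K = 2) (x : K) : conj F (conj F x) = x := by
  have := finite_of_finrank_eq_two hK
  have := Fintype.ofFinite K
  rw [conj_apply, conj_apply, ← pow_mul, ← pow_two, ← natCard_eq_sq hK,
    Nat.card_eq_fintype_card, FiniteField.pow_card]

theorem algebraMap_norm (hK : Module.finrank F K = 2) (x : K) :
    algebraMap F K (Algebra.norm F x) = x * conj F x := by
  have := finite_of_finrank_eq_two hK
  rw [FiniteField.algebraMap_norm_eq_prod_pow, hK, conj_apply]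
  simp [Finset.prod_range_succ]

theorem algebraMap_trace (hK : Module.finrank F K = 2) (x : K) :
    algebraMap F K (Algebra.trace F K x) = x + conj F x := by
  have := finite_of_finrank_eq_two hK
  rw [FiniteField.algebraMap_trace_eq_sum_pow, hK, conj_apply]
  simp [Finset.sum_range_succ]

theorem mul_conj_eq_zero {x : K} : x * conj F x = 0 ↔ x = 0 := by
  rw [conj_apply, ← pow_succ', pow_eq_zero_iff (Nat.succ_ne_zero _)]

theorem conj_eq_self_iff (x : K) :
    conj F x = x ↔ x ∈ Set.range (algebraMap F K) := by
  classical
  constructor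
  · intro h
    by_contra hx
    -- otherwise `X ^ q - X` has the `q` elements of `F` and also `x` as roots
    have hinj := (algebraMap F K).injective
    set S : Finset K := insert x (Finset.univ.image (algebraMap F K)) with hS
    have hcard : S.card = Fintype.card F + 1 := by
      rw [hS, Finset.card_insert_of_notMem, Finset.card_image_of_injective _ hinj,
        Finset.card_univ]
      simpa using hx
    have hq : 1 < Fintype.card F := Fintype.one_lt_card
    have hle : S.card ≤ (Polynomial.X ^ Fintype.card F - Polynomial.X : Polynomial K).natDegree := by
      apply Polynomial.card_le_degree_of_subset_roots
      intro y hy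
      rw [Finset.mem_val, hS, Finset.mem_insert, Finset.mem_image] at hy
      rw [Polynomial.mem_roots (FiniteField.X_pow_card_sub_X_ne_zero K hq)]
      simp only [Polynomial.IsRoot.def, Polynomial.eval_sub, Polynomial.eval_pow,
        Polynomial.eval_X, sub_eq_zero]
      rcases hy with rfl | ⟨c, -, rfl⟩
      · exact h
      · exact (conj F).commutes c
    rw [FiniteField.X_pow_card_sub_X_natDegree_eq K hq, hcard] at hle
    omega
  · rintro ⟨c, rfl⟩
    exact (conj F).commutes c

theorem conj_sub_self_ne_zero {b : K} (hb : b ∉ Set.range (algebraMap F K)) :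
    conj F b - b ≠ 0 := fun h => hb ((conj_eq_self_iff b).1 (sub_eq_zero.1 h))

theorem exists_norm_eq (hK : Module.finrank F K = 2) (k : F) :
    ∃ x : K, x * conj F x = algebraMap F K k := by
  have := finite_of_finrank_eq_two hK
  obtain ⟨x, rfl⟩ := FiniteField.norm_surjective F K k
  exact ⟨x, (algebraMap_norm hK x).symm⟩

/-- A nonzero element of `F` is the norm of exactly `q + 1` elements of `K`: all fibres of the
norm map on the units have the same size. -/
theorem ncard_norm_eq (hK : Module.finrank F K = 2) (k : F) (hk : k ≠ 0) :
    {x : K | x * conj F x = algebraMap F K k}.ncard = Fintype.card F + 1 := by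
  classical
  have := finite_of_finrank_eq_two hK
  have := Fintype.ofFinite K
  set f : Kˣ →* Fˣ := Units.map (Algebra.norm F)
  have hf : Function.Surjective f := FiniteField.unitsMap_norm_surjective F K
  have hfib : ∀ u : Fˣ, (Finset.univ.filter fun x => f x = u).card =
      (Finset.univ.filter fun x => f x = Units.mk0 k hk).card := fun u =>
    MonoidHom.card_fiber_eq_of_mem_range f (hf _) (hf _)
  have hsum : (Finset.univ : Finset Kˣ).card = ∑ u ∈ (Finset.univ : Finset Fˣ),
      (Finset.univ.filter fun x => f x = u).card :=
    Finset.card_eq_sum_card_fiberwise (fun _ _ => Finset.mem_coe.2 (Finset.mem_univ _))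
  rw [Finset.sum_congr rfl fun u _ => hfib u, Finset.sum_const, Finset.card_univ,
    Finset.card_univ, Fintype.card_units, Fintype.card_units, ← Nat.card_eq_fintype_card (α := K),
    natCard_eq_sq hK, smul_eq_mul] at hsum
  have hq : 1 < Fintype.card F := Fintype.one_lt_card
  have hset : {x : K | x * conj F x = algebraMap F K k} =
      ((Finset.univ.filter fun x => f x = Units.mk0 k hk).image Units.val : Finset K) := by
    ext x
    simp only [Set.mem_ofPred_eq, Finset.coe_image, Finset.coe_filter, Set.mem_image,
      Finset.mem_univ, true_and]
    constructor
    · intro hx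
      have hx0 : x ≠ 0 := by
        rintro rfl
        rw [zero_mul, eq_comm, map_eq_zero] at hx
        exact hk hx
      refine ⟨Units.mk0 x hx0, ?_, rfl⟩
      ext
      apply (algebraMap F K).injective
      simpa [f] using (algebraMap_norm hK x).trans hx
    · rintro ⟨u, hu, rfl⟩
      rw [← algebraMap_norm hK]
      exact congrArg (fun v : Fˣ => algebraMap F K v) hu
  rw [hset, Set.ncard_coe_finset, Finset.card_image_of_injective _ Units.val_injective]
  obtain ⟨r, hr⟩ : ∃ r, Fintype.card F = r + 2 := ⟨_, (Nat.sub_add_cancel hq).symm⟩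
  rw [hr] at hsum ⊢
  have h1 : (r + 2) ^ 2 - 1 = (r + 1) * (r + 2 + 1) := by
    rw [Nat.sub_eq_iff_eq_add (Nat.one_le_pow _ _ (by omega))]
    ring
  rw [h1, show r + 2 - 1 = r + 1 by omega] at hsum
  exact (Nat.eq_of_mul_eq_mul_left (by omega) hsum).symm

/-- The quadratic equation `t ² + t = d` is solvable over the field with `2 ^ e` elements if the
absolute trace of `d` is zero: otherwise the trace polynomial would have `2 ^ (e - 1) + 1` roots,
namely `d` and the values of `t ² + t`. -/
theorem exists_sq_add_self_eq [CharP F 2] {e : ℕ} (he : Fintype.card F = 2 ^ e) {d : F}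
    (hd : ∑ i ∈ Finset.range e, d ^ (2 ^ i) = 0) : ∃ t : F, t ^ 2 + t = d := by
  classical
  obtain ⟨e, rfl⟩ : ∃ n, e = n + 1 := by
    refine Nat.exists_eq_succ_of_ne_zero ?_
    rintro rfl
    have : 1 < Fintype.card F := Fintype.one_lt_card
    simp [he] at this
  by_contra! hno
  set T : Polynomial F := ∑ i ∈ Finset.range (e + 1), Polynomial.X ^ (2 ^ i) with hT
  have hdeg : T.natDegree ≤ 2 ^ e := by
    apply Polynomial.natDegree_sum_le_of_forall_le
    intro i hi
    rw [Polynomial.natDegree_X_pow]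
    exact Nat.pow_le_pow_right (by norm_num) (by simpa [Nat.lt_succ_iff] using hi)
  have hT0 : T ≠ 0 := by
    intro h
    have h1 := congrArg (fun p => Polynomial.coeff p 1) h
    have hne : ∀ i, 1 ≠ 2 ^ (i + 1) := fun i => (Nat.one_lt_two_pow (Nat.succ_ne_zero i)).ne
    simp [hT, Polynomial.finsetSum_coeff, Polynomial.coeff_X_pow, Finset.sum_range_succ',
      hne] at h1
  have hroot : ∀ t : F, ∑ i ∈ Finset.range (e + 1), (t ^ 2 + t) ^ (2 ^ i) = 0 := by
    intro t
    have hstep : ∀ i, (t ^ 2 + t) ^ (2 ^ i) = t ^ (2 ^ (i + 1)) - t ^ (2 ^ i) := by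
      intro i
      rw [add_pow_char_pow, ← pow_mul, ← pow_succ', CharTwo.sub_eq_add]
    rw [Finset.sum_congr rfl fun i _ => hstep i, Finset.sum_range_sub (fun i => t ^ (2 ^ i)), ← he,
      FiniteField.pow_card]
    simp
  set I : Finset F := Finset.univ.image fun t : F => t ^ 2 + t with hI
  have hIcard : 2 ^ (e + 1) ≤ 2 * I.card := by
    rw [← he, ← Finset.card_univ]
    refine Finset.card_le_mul_card_image _ _ fun y hy => ?_
    obtain ⟨t, -, rfl⟩ := Finset.mem_image.1 hy
    refine (Finset.card_le_card (t := {t, t + 1}) fun s hs => ?_).trans Finset.card_le_two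
    have hs' : (s - t) * (s - (t + 1)) = 0 := by
      have h := (Finset.mem_filter.1 hs).2
      have h2 : (2 : F) = 0 := CharTwo.two_eq_zero
      linear_combination h + (t ^ 2 + t - s - s * t) * h2
    rw [Finset.mem_insert, Finset.mem_singleton]
    rcases mul_eq_zero.1 hs' with h | h
    · exact Or.inl (sub_eq_zero.1 h)
    · exact Or.inr (sub_eq_zero.1 h)
  have hle : (insert d I).card ≤ T.natDegree := by
    apply Polynomial.card_le_degree_of_subset_roots
    intro y hy
    rw [Polynomial.mem_roots hT0, Polynomial.IsRoot.def, hT, Polynomial.eval_finsetSum]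
    simp only [Polynomial.eval_pow, Polynomial.eval_X]
    rw [Finset.mem_val, Finset.mem_insert, hI, Finset.mem_image] at hy
    rcases hy with rfl | ⟨t, -, rfl⟩
    · exact hd
    · exact hroot t
  rw [Finset.card_insert_of_notMem] at hle
  · rw [pow_succ] at hIcard
    omega
  · rw [hI, Finset.mem_image]
    rintro ⟨t, -, ht⟩
    exact hno t ht

/-- In a finite field the quotient of two non-squares is a square. -/
theorem isSquare_div_of_not_isSquare {x y : F} (hx : ¬ IsSquare x)
    (hy : ¬ IsSquare y) : IsSquare (x / y) := by
  classical
  have hy0 : y ≠ 0 := by rintro rfl; exact hy (IsSquare.zero)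
  have hx0 : x ≠ 0 := by rintro rfl; exact hx (IsSquare.zero)
  have h : quadraticChar F (x / y) = 1 := by
    have h1 : quadraticChar F (x / y) * quadraticChar F y = quadraticChar F x := by
      rw [← map_mul, div_mul_cancel₀ _ hy0]
    rw [quadraticChar_neg_one_iff_not_isSquare.2 hx,
      quadraticChar_neg_one_iff_not_isSquare.2 hy] at h1
    linarith
  exact (quadraticChar_one_iff_isSquare (div_ne_zero hx0 hy0)).1 h

/-- Ebert's condition says that the quadratic equation whose roots have sum `1` and product
`- a ^ (q + 1) / (b ^ q - b) ^ 2` has two distinct roots in `F`. -/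
theorem exists_roots_of_ebertCondition (hK : Module.finrank F K = 2) {a b : K}
    (hb : b ∉ Set.range (algebraMap F K)) (hE : EbertCondition F a b) :
    ∃ s t : F, s ≠ t ∧ s + t = 1 ∧
      algebraMap F K (s * t) * (conj F b - b) ^ 2 = -(a * conj F a) := by
  have hδ := conj_sub_self_ne_zero hb
  set δ := conj F b - b with hδdef
  have hδc : conj F δ = -δ := by rw [hδdef, map_sub, conj_conj hK]; ring
  have hN : a ^ (Fintype.card F + 1) = a * conj F a := by rw [conj_apply, pow_succ']
  have hsq : conj F (δ ^ 2) = δ ^ 2 := by rw [map_pow, hδc, neg_sq]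
  obtain ⟨D, hD⟩ := (conj_eq_self_iff _).1 hsq
  obtain ⟨n, hn⟩ : ∃ n : F, algebraMap F K n = a * conj F a := ⟨_, algebraMap_norm hK a⟩
  have hD0 : D ≠ 0 := by
    rintro rfl
    rw [map_zero] at hD
    exact hδ (pow_eq_zero_iff (two_ne_zero) |>.1 hD.symm)
  suffices h : ∃ s t : F, s ≠ t ∧ s + t = 1 ∧ s * t * D = -n by
    obtain ⟨s, t, hst, h1, h2⟩ := h
    exact ⟨s, t, hst, h1, by rw [← hD, ← map_mul, h2, map_neg, hn]⟩
  by_cases hF : ringChar F = 2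
  · have hF' : CharP F 2 := ringChar.of_eq hF
    have hK' : CharP K 2 := charP_of_injective_algebraMap' F 2
    obtain ⟨-, e, d, he, hd, hsum⟩ :=
      hE.2 (Nat.even_iff.2 (FiniteField.even_card_of_char_two hF))
    obtain ⟨t, ht⟩ := exists_sq_add_self_eq he hsum
    have hd' : d = n / D := by
      apply (algebraMap F K).injective
      rw [hd, map_div₀, hn, hD, hN, ← conj_apply F b, hδdef, CharTwo.sub_eq_add]
    have h2 : (2 : F) = 0 := CharTwo.two_eq_zero
    refine ⟨t, t + 1, fun h => one_ne_zero (left_eq_add.1 h), ?_, ?_⟩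
    · linear_combination t * h2
    · have : t ^ 2 + t = n / D := ht.trans hd'
      rw [eq_div_iff hD0] at this
      linear_combination this + n * h2
  · obtain ⟨d, hd, hns⟩ := hE.1 (Nat.odd_iff.2 (FiniteField.odd_card_of_char_ne_two hF))
    have h2 : (2 : F) ≠ 0 := Ring.two_ne_zero hF
    have hd' : d = 4 * n + D := by
      apply (algebraMap F K).injective
      rw [hd, hN, ← conj_apply F b, map_add, map_mul, hn, hD, map_ofNat]
    have hDns : ¬ IsSquare D := by
      rintro ⟨r, rfl⟩
      rw [map_mul, ← pow_two, sq_eq_sq_iff_eq_or_eq_neg] at hD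
      have hfix : conj F δ = δ := by
        rw [conj_eq_self_iff]
        rcases hD with h | h
        · exact ⟨r, h⟩
        · exact ⟨-r, by rw [map_neg, h, neg_neg]⟩
      rw [hδc] at hfix
      have : (2 : K) * δ = 0 := by linear_combination -hfix
      rcases mul_eq_zero.1 this with h | h
      · apply h2
        apply (algebraMap F K).injective
        rw [map_zero, ← h, map_ofNat]
      · exact hδ h
    obtain ⟨r, hr⟩ := isSquare_div_of_not_isSquare hns hDns
    have hr0 : r ≠ 0 := by
      rintro rfl
      rw [mul_zero, div_eq_zero_iff] at hr
      rcases hr with rfl | h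
      · exact hns IsSquare.zero
      · exact hD0 h
    refine ⟨(1 + r) / 2, (1 - r) / 2, ?_, ?_, ?_⟩
    · intro h
      apply hr0
      field_simp at h
      have : 2 * r = 0 := by linear_combination h
      exact (mul_eq_zero.1 this).resolve_left h2
    · field_simp
      ring
    · rw [div_eq_iff hD0, hd'] at hr
      field_simp
      linear_combination hr

/-- The pair `(α, β)` turns the quadratic part of the curve into a norm: the first two conditions
say that `a x ² - a ^ q x ^ (2 q) + (b ^ q - b) x ^ (q + 1)` is
`(b ^ q - b) (α x + β x ^ q) ^ (q + 1)` for all `x`, and the last one that `x ↦ α x + β x ^ q` is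
bijective. -/
structure IsNormalization (F : Type*) {K : Type*} [Field F] [Fintype F] [Field K] [Algebra F K]
    (a b α β : K) : Prop where
  mul_conj : (conj F b - b) * (α * conj F β) = a
  norm_add_norm : α * conj F α + β * conj F β = 1
  norm_ne_norm : α * conj F α ≠ β * conj F β

/-- The roots in `F` provided by Ebert's condition are taken as the norms of `α` and `β`. -/
theorem exists_isNormalization (hK : Module.finrank F K = 2) {a b : K} (ha : a ≠ 0)
    (hb : b ∉ Set.range (algebraMap F K)) (hE : EbertCondition F a b) :
    ∃ α β : K, IsNormalization F a b α β := by
  obtain ⟨s, t, hst, hsum, hprod⟩ := exists_roots_of_ebertCondition hK hb hE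
  have hδ := conj_sub_self_ne_zero hb
  obtain ⟨β, hβ⟩ := exists_norm_eq (K := K) hK t
  set δ := conj F b - b with hδdef
  have hδc : conj F δ = -δ := by rw [hδdef, map_sub, conj_conj hK]; ring
  have hβ0 : β ≠ 0 := by
    rintro rfl
    rw [zero_mul, eq_comm, map_eq_zero] at hβ
    rw [hβ, mul_zero, map_zero, zero_mul, eq_comm, neg_eq_zero, mul_conj_eq_zero] at hprod
    exact ha hprod
  have hβc : conj F β ≠ 0 := (map_ne_zero _).2 hβ0
  have ht0 : algebraMap F K t ≠ 0 := hβ ▸ mul_ne_zero hβ0 hβc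
  have hα : a / (δ * conj F β) * conj F (a / (δ * conj F β)) = algebraMap F K s := by
    rw [map_div₀, map_mul, conj_conj hK, hδc]
    rw [map_mul] at hprod
    have h1 : algebraMap F K s * (algebraMap F K t) * δ ^ 2 = -(a * conj F a) := hprod
    rw [← hβ] at h1
    field_simp
    linear_combination -h1
  refine ⟨a / (δ * conj F β), β, ?_, ?_, ?_⟩
  · rw [← hδdef]
    field_simp
  · rw [hα, hβ, ← map_add, hsum, map_one]
  · rw [hα, hβ]
    exact fun h => hst ((algebraMap F K).injective h)

/-- Ebert's condition cannot hold for `q = 2` or `q = 3` if `a ≠ 0`: the two roots in `F` with sum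
`1` and nonzero product are distinct from each other and from `0` and `1`. -/
theorem four_le_card (hK : Module.finrank F K = 2) {a b : K} (ha : a ≠ 0)
    (hb : b ∉ Set.range (algebraMap F K)) (hE : EbertCondition F a b) :
    4 ≤ Fintype.card F := by
  classical
  obtain ⟨s, t, hst, hsum, hprod⟩ := exists_roots_of_ebertCondition hK hb hE
  have hst0 : s * t ≠ 0 := by
    intro h
    rw [h, map_zero, zero_mul, eq_comm, neg_eq_zero, mul_conj_eq_zero] at hprod
    exact ha hprod
  have hs0 : s ≠ 0 := left_ne_zero_of_mul hst0
  have ht0 : t ≠ 0 := right_ne_zero_of_mul hst0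
  have hs1 : s ≠ 1 := by
    rintro rfl
    exact ht0 (left_eq_add.1 hsum.symm)
  have ht1 : t ≠ 1 := by
    rintro rfl
    exact hs0 (right_eq_add.1 hsum.symm)
  have hcard : ({0, 1, s, t} : Finset F).card = 4 := by
    rw [Finset.card_insert_of_notMem, Finset.card_insert_of_notMem, Finset.card_pair hst]
    · simp [hs1.symm, ht1.symm]
    · simp [hs0.symm, ht0.symm]
  exact hcard ▸ Finset.card_le_univ _

end QuadraticExtension

/-! ### The straightened curve is a unital -/

section EbertSet

variable (F : Type*) {K : Type*} [Field F] [Fintype F] [Field K] [Algebra F K]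

/-- The equation of the straightened curve in affine coordinates: it says that
`y + a x ² - b x ^ (q + 1)` lies in `F`. -/
def EbertEquation (a b x y : K) : Prop :=
  conj F y - y + conj F (a * x ^ 2) - a * x ^ 2 = (conj F b - b) * (x * conj F x)

/-- The image of the completed Hermitian curve under the straightening isomorphism, in coordinates
of the projective plane. -/
def ebertSet (a b : K) : Set (PGPoint K) :=
  insert (pointAtInfinity none) {p | ∃ x y, EbertEquation F a b x y ∧ p = affinePoint x y}

theorem image_completedCurve (a b : K) :
    straightenEquiv a '' completedCurve (Fintype.card F) a b = ebertSet F a b := by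
  rw [completedCurve, ebertSet, Set.image_insert_eq, straightenEquiv_yInfinity, Set.image_image]
  congr 1
  ext p
  simp only [Set.mem_image, Set.mem_ofPred_eq, hermitianCurve, Prod.exists, straightenEquiv_inl,
    ← conj_apply, EbertEquation]
  constructor
  · rintro ⟨x, y, h, rfl⟩
    refine ⟨x, y - a * x ^ 2, ?_, rfl⟩
    rw [pow_succ', ← conj_apply] at h
    rw [map_sub]
    linear_combination h
  · rintro ⟨x, y, h, rfl⟩
    refine ⟨x, y + a * x ^ 2, ?_, by rw [add_sub_cancel_right]⟩
    rw [pow_succ' x (Fintype.card F), ← conj_apply, map_add]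
    linear_combination h

variable {F}

theorem affinePoint_mem_ebertSet {a b x y : K} :
    affinePoint x y ∈ ebertSet F a b ↔ EbertEquation F a b x y := by
  constructor
  · rintro (h | ⟨x', y', h, hxy⟩)
    · exact (affinePoint_ne_pointAtInfinity _ _ _ h).elim
    · obtain ⟨rfl, rfl⟩ := affinePoint_inj hxy
      exact h
  · exact fun h => Or.inr ⟨x, y, h, rfl⟩

theorem pointAtInfinity_mem_ebertSet {a b : K} {o : Option K} :
    pointAtInfinity o ∈ ebertSet F a b ↔ o = none := by
  constructor
  · rintro (h | ⟨x', y', h, hxy⟩)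
    · exact pointAtInfinity_injective h
    · exact (affinePoint_ne_pointAtInfinity _ _ _ hxy.symm).elim
  · rintro rfl
    exact Or.inl rfl

variable (F) in
/-- The `F`-linear map `x ↦ α x + β x ^ q`. -/
def semilinearComb (α β : K) : K →ₗ[F] K :=
  LinearMap.mulLeft F α + LinearMap.mulLeft F β ∘ₗ (conj F : K →ₐ[F] K).toLinearMap

theorem semilinearComb_apply (α β x : K) :
    semilinearComb F α β x = α * x + β * conj F x := rfl

variable {a b α β : K}

theorem IsNormalization.equation_iff (hK : Module.finrank F K = 2)
    (h : IsNormalization F a b α β) (x y : K) :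
    EbertEquation F a b x y ↔ conj F y - y = (conj F b - b) *
      (semilinearComb F α β x * conj F (semilinearComb F α β x)) := by
  have h1 := h.mul_conj
  have h2 := congrArg (conj F) h1
  have h3 := h.norm_add_norm
  rw [EbertEquation, semilinearComb_apply]
  simp only [map_mul, map_sub, map_add, map_pow, conj_conj hK] at h2 ⊢
  rw [← sub_eq_zero, ← sub_eq_zero (a := conj F y - y)]
  refine Eq.congr ?_ rfl
  linear_combination x ^ 2 * h1 - (conj F x) ^ 2 * h2 + (conj F b - b) * (x * conj F x) * h3

theorem IsNormalization.injective (hK : Module.finrank F K = 2)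
    (h : IsNormalization F a b α β) : Function.Injective (semilinearComb F α β) := by
  rw [← LinearMap.ker_eq_bot, LinearMap.ker_eq_bot']
  intro x hx
  rw [semilinearComb_apply] at hx
  have hx' := congrArg (conj F) hx
  simp only [map_mul, map_add, conj_conj hK, map_zero] at hx'
  have h0 : (α * conj F α - β * conj F β) * (x * conj F x) = 0 := by
    linear_combination (conj F α * conj F x) * hx - (β * conj F x) * hx'
  exact mul_conj_eq_zero.1 ((mul_eq_zero.1 h0).resolve_left (sub_ne_zero.2 h.norm_ne_norm))

theorem IsNormalization.bijective (hK : Module.finrank F K = 2)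
    (h : IsNormalization F a b α β) : Function.Bijective (semilinearComb F α β) := by
  have := finite_of_finrank_eq_two hK
  exact Finite.injective_iff_bijective.1 (h.injective hK)

theorem IsNormalization.equation_iff_exists (hK : Module.finrank F K = 2)
    (h : IsNormalization F a b α β) (x y : K) :
    EbertEquation F a b x y ↔ ∃ r : F, b * (semilinearComb F α β x *
      conj F (semilinearComb F α β x)) + algebraMap F K r = y := by
  rw [h.equation_iff hK]
  set z := semilinearComb F α β x
  have hz : conj F (z * conj F z) = z * conj F z := by rw [map_mul, conj_conj hK, mul_comm]
  constructor
  · intro hy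
    obtain ⟨r, hr⟩ := (conj_eq_self_iff (F := F) (y - b * (z * conj F z))).1 (by
      rw [map_sub, map_mul, hz]
      linear_combination hy)
    exact ⟨r, by rw [hr]; ring⟩
  · rintro ⟨r, rfl⟩
    rw [map_add, map_mul, hz, AlgHom.commutes]
    ring

/-- A vertical line meets the curve in a coset of `F`. -/
theorem ncard_vertical (hK : Module.finrank F K = 2) (h : IsNormalization F a b α β) (x : K) :
    {y | EbertEquation F a b x y}.ncard = Fintype.card F := by
  have hset : {y | EbertEquation F a b x y} = Set.range fun r : F => b * (semilinearComb F α β x *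
      conj F (semilinearComb F α β x)) + algebraMap F K r := by
    ext y
    exact h.equation_iff_exists hK x y
  rw [hset, Set.ncard_range_of_injective, Nat.card_eq_fintype_card]
  exact (add_right_injective _).comp (algebraMap F K).injective

/-- A line `y = m x + d` meets the curve in `1` or `q + 1` affine points: in terms of
`z = α x + β x ^ q` the equation becomes `(z - ν) ^ (q + 1) = k` with `k ∈ F`. -/
theorem ncard_oblique (hK : Module.finrank F K = 2) (hb : b ∉ Set.range (algebraMap F K))
    (h : IsNormalization F a b α β) (m d : K) :
    {x | EbertEquation F a b x (m * x + d)}.ncard = 1 ∨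
      {x | EbertEquation F a b x (m * x + d)}.ncard = Fintype.card F + 1 := by
  have hδ := conj_sub_self_ne_zero hb
  have hδc : conj F (conj F b - b) = -(conj F b - b) := by rw [map_sub, conj_conj hK]; ring
  have hD := sub_ne_zero.2 h.norm_ne_norm
  have hDc : conj F (α * conj F α - β * conj F β) = α * conj F α - β * conj F β := by
    rw [map_sub, map_mul, map_mul, conj_conj hK, conj_conj hK]; ring
  set δ := conj F b - b with hδdef
  set D := α * conj F α - β * conj F β with hDdef
  obtain ⟨ν, hν⟩ : ∃ ν, ν * (D * δ) = m * β + conj F m * α :=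
    ⟨_, div_mul_cancel₀ _ (mul_ne_zero hD hδ)⟩
  have hνc := congrArg (conj F) hν
  simp only [map_mul, map_add, conj_conj hK, hDc, hδc] at hνc
  obtain ⟨k, hk⟩ := (conj_eq_self_iff (F := F) ((conj F d - d) / δ + ν * conj F ν)).1 (by
    rw [map_add, map_div₀, hδc, map_sub, conj_conj hK, map_mul, conj_conj hK]
    field_simp
    ring)
  have hset : {x | EbertEquation F a b x (m * x + d)} =
      (fun x => semilinearComb F α β x - ν) ⁻¹' {z | z * conj F z = algebraMap F K k} := by
    ext x
    rw [Set.mem_preimage, Set.mem_ofPred_eq, Set.mem_ofPred_eq, h.equation_iff hK, hk, ← hδdef,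
      map_sub, map_add, map_mul]
    set z := semilinearComb F α β x with hz
    have hzx : z = α * x + β * conj F x := rfl
    have hzc : conj F z = conj F α * conj F x + conj F β * x := by
      rw [hzx, map_add, map_mul, map_mul, conj_conj hK]
    have hlin : δ * (z * conj F ν + conj F z * ν) = conj F m * conj F x - m * x := by
      apply mul_left_cancel₀ hD
      rw [hzc, hzx, hDdef]
      rw [hDdef] at hν hνc
      linear_combination (conj F α * conj F x + conj F β * x) * hν - (α * x + β * conj F x) * hνc
    have hdiv : (conj F d - d) / δ * δ = conj F d - d := div_mul_cancel₀ _ hδ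
    constructor
    · intro he
      apply mul_left_cancel₀ hδ
      linear_combination -he - hlin - hdiv
    · intro he
      linear_combination -δ * he - hlin - hdiv
  have hbij : Function.Bijective fun x => semilinearComb F α β x - ν :=
    (Equiv.subRight ν).bijective.comp (h.bijective hK)
  rw [hset, Set.ncard_preimage_of_injective_subset_range hbij.1
    (by rw [hbij.2.range_eq]; exact Set.subset_univ _)]
  by_cases hk0 : k = 0
  · left
    have : {z : K | z * conj F z = algebraMap F K k} = {0} := by
      ext z
      rw [Set.mem_ofPred_eq, hk0, map_zero, mul_conj_eq_zero, Set.mem_singleton_iff]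
    rw [this, Set.ncard_singleton]
  · right
    exact ncard_norm_eq hK k hk0

theorem ncard_ebertSet (hK : Module.finrank F K = 2) (h : IsNormalization F a b α β) :
    (ebertSet F a b).ncard = Fintype.card F ^ 3 + 1 := by
  have := finite_of_finrank_eq_two hK
  have hset : {p | ∃ x y, EbertEquation F a b x y ∧ p = affinePoint x y} =
      Set.range fun t : K × F => affinePoint t.1 (b * (semilinearComb F α β t.1 *
        conj F (semilinearComb F α β t.1)) + algebraMap F K t.2) := by
    ext p
    simp only [Set.mem_ofPred_eq, Set.mem_range, Prod.exists, h.equation_iff_exists hK]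
    constructor
    · rintro ⟨x, _, ⟨r, rfl⟩, rfl⟩
      exact ⟨x, r, rfl⟩
    · rintro ⟨x, r, rfl⟩
      exact ⟨x, _, ⟨r, rfl⟩, rfl⟩
  rw [ebertSet, hset, Set.ncard_insert_of_notMem _ (Set.finite_range _),
    Set.ncard_range_of_injective, Nat.card_prod, natCard_eq_sq hK, Nat.card_eq_fintype_card]
  · ring
  · rintro ⟨x, r⟩ ⟨x', r'⟩ hxr
    obtain ⟨rfl, h2⟩ := affinePoint_inj hxr
    exact congrArg (Prod.mk x) ((algebraMap F K).injective (add_left_cancel h2))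
  · rintro ⟨t, ht⟩
    exact affinePoint_ne_pointAtInfinity _ _ _ ht

theorem isUnital_ebertSet (hK : Module.finrank F K = 2) (hb : b ∉ Set.range (algebraMap F K))
    (h : IsNormalization F a b α β) : IsUnital (PG2 K) (Fintype.card F) (ebertSet F a b) := by
  have := finite_of_finrank_eq_two hK
  refine ⟨ncard_ebertSet hK h, fun l hl => ?_⟩
  rw [mem_PG2_lines_iff_normal_form] at hl
  rcases hl with ⟨m, d, rfl⟩ | ⟨k, rfl⟩ | rfl
  · have hset : ebertSet F a b ∩ coordLine ![-d, -m, 1] =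
        (fun x => affinePoint x (m * x + d)) '' {x | EbertEquation F a b x (m * x + d)} := by
      ext p
      obtain ⟨x, y, rfl⟩ | ⟨o, rfl⟩ := affinePoint_or_pointAtInfinity p
      · rw [Set.mem_inter_iff, affinePoint_mem_ebertSet, affinePoint_mem_coordLine]
        simp only [Matrix.cons_val]
        constructor
        · rintro ⟨h1, h2⟩
          obtain rfl : y = m * x + d := by linear_combination h2
          exact ⟨x, h1, rfl⟩
        · rintro ⟨x', h1, h2⟩
          obtain ⟨rfl, rfl⟩ := affinePoint_inj h2
          exact ⟨h1, by ring⟩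
      · refine iff_of_false ?_ ?_
        · rintro ⟨h1, h2⟩
          rw [pointAtInfinity_mem_ebertSet] at h1
          rw [h1, pointAtInfinity_none_mem_coordLine] at h2
          exact one_ne_zero h2
        · rintro ⟨x', -, h2⟩
          exact affinePoint_ne_pointAtInfinity _ _ _ h2
    rw [hset, Set.ncard_image_of_injective _ fun x x' hx => (affinePoint_inj hx).1]
    exact ncard_oblique hK hb h m d
  · right
    have hset : ebertSet F a b ∩ coordLine ![-k, 1, 0] =
        insert (pointAtInfinity none) (affinePoint k '' {y | EbertEquation F a b k y}) := by
      ext p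
      obtain ⟨x, y, rfl⟩ | ⟨o, rfl⟩ := affinePoint_or_pointAtInfinity p
      · rw [Set.mem_inter_iff, affinePoint_mem_ebertSet, affinePoint_mem_coordLine]
        simp only [Matrix.cons_val]
        constructor
        · rintro ⟨h1, h2⟩
          obtain rfl : x = k := by linear_combination h2
          exact Or.inr ⟨y, h1, rfl⟩
        · rintro (h1 | ⟨y', h1, h2⟩)
          · exact (affinePoint_ne_pointAtInfinity _ _ _ h1).elim
          · obtain ⟨rfl, rfl⟩ := affinePoint_inj h2
            exact ⟨h1, by ring⟩
      · rw [Set.mem_inter_iff, pointAtInfinity_mem_ebertSet]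
        constructor
        · rintro ⟨rfl, -⟩
          exact Or.inl rfl
        · rintro (h1 | ⟨y', -, h2⟩)
          · rw [h1, pointAtInfinity_none_mem_coordLine]
            exact ⟨pointAtInfinity_injective h1, rfl⟩
          · exact (affinePoint_ne_pointAtInfinity _ _ _ h2).elim
    rw [hset, Set.ncard_insert_of_notMem _ (Set.toFinite _),
      Set.ncard_image_of_injective _ fun y y' hy => (affinePoint_inj hy).2,
      ncard_vertical hK h]
    rintro ⟨y, -, hy⟩
    exact affinePoint_ne_pointAtInfinity _ _ _ hy
  · left
    have hset : ebertSet F a b ∩ coordLine ![1, 0, 0] = {pointAtInfinity none} := by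
      ext p
      rw [Set.mem_inter_iff, Set.mem_singleton_iff]
      obtain ⟨x, y, rfl⟩ | ⟨o, rfl⟩ := affinePoint_or_pointAtInfinity p
      · rw [affinePoint_mem_coordLine]
        simp [affinePoint_ne_pointAtInfinity]
      · rw [pointAtInfinity_mem_ebertSet, pointAtInfinity_injective.eq_iff]
        constructor
        · exact fun h => h.1
        · rintro rfl
          exact ⟨rfl, by rw [pointAtInfinity_none_mem_coordLine]; rfl⟩
    rw [hset, Set.ncard_singleton]

end EbertSet

/-! ### The straightened curve is represented by a cone over an elliptic quadric -/

section Cone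

variable {F K : Type*} [Field F] [Fintype F] [Field K] [Algebra F K]

variable (F) in
/-- The `F`-linear functional `y ↦ (y ^ q - y) / (b ^ q - b)` on `K`. Its kernel is `F`. -/
def coordFunctional (b : K) : K →ₗ[F] F :=
  Algebra.trace F K ∘ₗ LinearMap.mulLeft F (-(conj F b - b)⁻¹)

theorem mul_coordFunctional (hK : Module.finrank F K = 2) {b : K}
    (hb : b ∉ Set.range (algebraMap F K)) (y : K) :
    (conj F b - b) * algebraMap F K (coordFunctional F b y) = conj F y - y := by
  have hδ := conj_sub_self_ne_zero hb
  have hδ' : b - conj F b ≠ 0 := fun h => hδ (by rw [← neg_sub, h, neg_zero])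
  change (conj F b - b) * algebraMap F K (Algebra.trace F K (-(conj F b - b)⁻¹ * y)) = _
  rw [algebraMap_trace hK, map_mul, map_neg, map_inv₀, map_sub, conj_conj hK]
  field_simp
  ring

theorem coordFunctional_eq_zero_iff (hK : Module.finrank F K = 2) {b : K}
    (hb : b ∉ Set.range (algebraMap F K)) (y : K) :
    coordFunctional F b y = 0 ↔ y ∈ Set.range (algebraMap F K) := by
  rw [← conj_eq_self_iff, ← sub_eq_zero (b := y), ← mul_coordFunctional hK hb, mul_eq_zero,
    or_iff_right (conj_sub_self_ne_zero hb), map_eq_zero (algebraMap F K)]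

variable (F) in
/-- The `K`-valued bilinear map whose quadratic map is
`(t, x, y) ↦ t y - b (α x + β x ^ q) ^ (q + 1)`. -/
def coneBilin (b α β : K) : LinearMap.BilinMap F (F × K × K) K :=
  LinearMap.mk₂ F
    (fun m n => m.1 • n.2.2 - b * (semilinearComb F α β m.2.1 *
      conj F (semilinearComb F α β n.2.1)))
    (fun m m' n => by simp only [Prod.fst_add, Prod.snd_add, add_smul, map_add]; ring)
    (fun c m n => by
      simp only [Prod.smul_fst, Prod.smul_snd, smul_assoc, map_smul, smul_sub, smul_mul_assoc,
        mul_smul_comm])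
    (fun m n n' => by simp only [Prod.fst_add, Prod.snd_add, smul_add, map_add]; ring)
    (fun c m n => by
      simp only [Prod.smul_fst, Prod.smul_snd, map_smul, smul_sub, mul_smul_comm,
        smul_comm m.1 c])

variable (F) in
/-- The quadratic form on `F × K × K` whose zeros represent the straightened curve. Its radical is
spanned by `(0, 0, 1)`. -/
def coneForm (b α β : K) : QuadraticForm F (F × K × K) :=
  (coordFunctional F b).compQuadraticMap (coneBilin F b α β).toQuadraticMap

theorem coneForm_apply (b α β : K) (m : F × K × K) :
    coneForm F b α β m = coordFunctional F b (m.1 • m.2.2 - b * (semilinearComb F α β m.2.1 *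
      conj F (semilinearComb F α β m.2.1))) := rfl

theorem polar_coneForm (b α β : K) (m n : F × K × K) :
    QuadraticMap.polar (coneForm F b α β) m n =
      coordFunctional F b (m.1 • n.2.2 + n.1 • m.2.2 -
        b * (semilinearComb F α β m.2.1 * conj F (semilinearComb F α β n.2.1) +
          semilinearComb F α β n.2.1 * conj F (semilinearComb F α β m.2.1))) := by
  rw [QuadraticMap.polar, coneForm_apply, coneForm_apply, coneForm_apply, ← map_sub, ← map_sub]
  congr 1
  simp only [Prod.fst_add, Prod.snd_add, add_smul, smul_add, map_add]
  ring

theorem coneForm_eq_zero_iff (hK : Module.finrank F K = 2) {b : K}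
    (hb : b ∉ Set.range (algebraMap F K)) (α β : K) (m : F × K × K) :
    coneForm F b α β m = 0 ↔ algebraMap F K m.1 * (conj F m.2.2 - m.2.2) = (conj F b - b) *
      (semilinearComb F α β m.2.1 * conj F (semilinearComb F α β m.2.1)) := by
  rw [coneForm_apply, coordFunctional_eq_zero_iff hK hb, ← conj_eq_self_iff, Algebra.smul_def]
  simp only [map_sub, map_mul, conj_conj hK, AlgHom.commutes]
  constructor <;> intro h <;> linear_combination h

/-- At infinity the form is the negative of a norm of `α x + β x ^ q`, so its zeros have `x = 0`. -/
theorem snd_fst_eq_zero_of_coneForm_eq_zero (hK : Module.finrank F K = 2) {a b α β : K}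
    (hb : b ∉ Set.range (algebraMap F K)) (h : IsNormalization F a b α β) {m : F × K × K}
    (hm : coneForm F b α β m = 0) (hm1 : m.1 = 0) : m.2.1 = 0 := by
  rw [coneForm_eq_zero_iff hK hb, hm1, map_zero, zero_mul, eq_comm, mul_eq_zero,
    or_iff_right (conj_sub_self_ne_zero hb), mul_conj_eq_zero] at hm
  exact h.injective hK (hm.trans (map_zero _).symm)

theorem mem_span_vertex_iff {F K : Type*} [Field F] [Field K] [Algebra F K] (m : F × K × K) :
    m ∈ F ∙ ((0, 0, 1) : F × K × K) ↔
      m.1 = 0 ∧ m.2.1 = 0 ∧ m.2.2 ∈ Set.range (algebraMap F K) := by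
  obtain ⟨t, x, y⟩ := m
  rw [Submodule.mem_span_singleton]
  constructor
  · rintro ⟨c, hc⟩
    simp only [Prod.smul_mk, smul_zero, Prod.mk.injEq] at hc
    exact ⟨hc.1.symm, hc.2.1.symm, c, by rw [← hc.2.2, Algebra.smul_def, mul_one]⟩
  · rintro ⟨h1, h2, c, hc⟩
    refine ⟨c, ?_⟩
    simp only [Prod.smul_mk, smul_zero, Prod.mk.injEq]
    exact ⟨h1.symm, h2.symm, by rw [Algebra.smul_def, mul_one, hc]⟩

theorem coneForm_vertex_add (hK : Module.finrank F K = 2) {b : K}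
    (hb : b ∉ Set.range (algebraMap F K)) (α β : K) (c : F) (m : F × K × K) :
    coneForm F b α β (c • (0, 0, 1) + m) = 0 ↔ coneForm F b α β m = 0 := by
  rw [coneForm_eq_zero_iff hK hb, coneForm_eq_zero_iff hK hb]
  simp [Algebra.smul_def]

theorem quadricCone_coneForm (hK : Module.finrank F K = 2) {b : K}
    (hb : b ∉ Set.range (algebraMap F K)) (α β : K) {H : Submodule F (F × K × K)}
    (hH : IsCompl (F ∙ ((0, 0, 1) : F × K × K)) H) :
    quadricCone (0, 0, 1) H ((coneForm F b α β).comp H.subtype) =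
      {m | coneForm F b α β m = 0} := by
  ext m
  constructor
  · rintro ⟨c, h, hh, rfl⟩
    exact (coneForm_vertex_add hK hb α β c _).2 hh
  · intro hm
    obtain ⟨u, hu, h, hh, rfl⟩ := Submodule.mem_sup.1
      (show m ∈ (F ∙ ((0, 0, 1) : F × K × K)) ⊔ H from hH.sup_eq_top ▸ Submodule.mem_top)
    obtain ⟨c, rfl⟩ := Submodule.mem_span_singleton.1 hu
    exact ⟨c, ⟨h, hh⟩, (coneForm_vertex_add hK hb α β c _).1 hm, rfl⟩

/-- The radical of the quadratic form is spanned by the vertex of the cone. -/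
theorem mem_span_vertex_of_polar_eq_zero (hK : Module.finrank F K = 2) {a b α β : K}
    (hb : b ∉ Set.range (algebraMap F K)) (h : IsNormalization F a b α β) {m : F × K × K}
    (hm : ∀ n, QuadraticMap.polar (coneForm F b α β) m n = 0) :
    m ∈ F ∙ ((0, 0, 1) : F × K × K) := by
  have hδ := conj_sub_self_ne_zero hb
  simp only [polar_coneForm] at hm
  have h1 : m.1 = 0 := by
    have h1 := hm (0, 0, b)
    simp only [map_zero, mul_zero, zero_mul, zero_smul, add_zero, sub_zero, map_smul] at h1
    refine (smul_eq_zero.1 h1).resolve_right fun h => hb ?_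
    exact (coordFunctional_eq_zero_iff hK hb b).1 h
  have h3 : m.2.2 ∈ Set.range (algebraMap F K) := by
    have h3 := hm (1, 0, 0)
    simp only [map_zero, mul_zero, zero_mul, smul_zero, add_zero, sub_zero, one_smul,
      zero_add] at h3
    exact (coordFunctional_eq_zero_iff hK hb _).1 h3
  refine (mem_span_vertex_iff m).2 ⟨h1, ?_, h3⟩
  set w := semilinearComb F α β m.2.1 with hw
  have h2 : ∀ z, w * conj F z + z * conj F w = 0 := by
    intro z
    obtain ⟨x, rfl⟩ := (h.bijective hK).2 z
    have h2 := hm (0, x, 0)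
    rw [coordFunctional_eq_zero_iff hK hb, ← conj_eq_self_iff] at h2
    simp only [smul_zero, zero_smul, add_zero, zero_sub, map_neg, map_mul, map_add, conj_conj hK] at h2
    refine (mul_eq_zero.1 ?_).resolve_left hδ
    linear_combination -h2
  by_contra hx
  have hw0 : w ≠ 0 := fun hw0 => hx (h.injective hK (hw0.trans (map_zero _).symm))
  have hwc : conj F w ≠ 0 := (map_ne_zero _).2 hw0
  -- a degenerate trace form would make the trace vanish on `1` and on `b`
  have htr : ∀ s : K, s + conj F s = 0 := by
    intro s
    have := h2 (conj F (s / w))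
    rwa [conj_conj hK, map_div₀, mul_div_cancel₀ _ hw0, div_mul_cancel₀ _ hwc] at this
  have ht1 := htr 1
  have htb := htr b
  rw [map_one] at ht1
  exact hδ (by linear_combination htb - b * ht1)

theorem finrank_le_one_of_linear_functional {F M : Type*} [Field F] [AddCommGroup M] [Module F M]
    (S : Submodule F M) (f : M →ₗ[F] F) (hf : ∀ s ∈ S, f s = 0 → s = 0) :
    Module.finrank F S ≤ 1 := by
  have hinj : Function.Injective (f ∘ₗ S.subtype) := by
    rw [← LinearMap.ker_eq_bot, LinearMap.ker_eq_bot']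
    exact fun s hs => Subtype.ext (hf s s.2 hs)
  simpa using LinearMap.finrank_le_finrank_of_injective hinj

/-- Restricted to a complement of the radical, the form is elliptic. In a totally singular subspace
`S`, the vectors with `t = 0` have `x = 0`; if `t` does not vanish on `S`, they are even zero. -/
theorem isElliptic_coneForm (hK : Module.finrank F K = 2) {a b α β : K}
    (hb : b ∉ Set.range (algebraMap F K)) (h : IsNormalization F a b α β)
    {H : Submodule F (F × K × K)} (hH : IsCompl (F ∙ ((0, 0, 1) : F × K × K)) H) :
    IsElliptic ((coneForm F b α β).comp H.subtype) := by
  have hfd : FiniteDimensional F K := FiniteDimensional.of_finrank_pos (by omega)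
  have hmem : ∀ m : H, (m : F × K × K) ∈ F ∙ ((0, 0, 1) : F × K × K) → m = 0 := fun m hm =>
    Subtype.ext (Submodule.disjoint_def.1 hH.disjoint _ hm m.2)
  refine ⟨?_, fun m hm => ?_, fun S hS => ?_⟩
  · have h1 := Submodule.finrank_add_eq_of_isCompl hH
    rw [finrank_span_singleton (fun h => one_ne_zero (congrArg (fun m => m.2.2) h)),
      Module.finrank_prod, Module.finrank_prod, hK, Module.finrank_self] at h1
    omega
  · refine hmem m (mem_span_vertex_of_polar_eq_zero hK hb h fun n => ?_)
    obtain ⟨u, hu, n', hn', rfl⟩ := Submodule.mem_sup.1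
      (show n ∈ (F ∙ ((0, 0, 1) : F × K × K)) ⊔ H from hH.sup_eq_top ▸ Submodule.mem_top)
    rw [QuadraticMap.polar_add_right]
    have h1 : QuadraticMap.polar (coneForm F b α β) m u = 0 := by
      obtain ⟨c, rfl⟩ := Submodule.mem_span_singleton.1 hu
      rw [polar_coneForm, coordFunctional_eq_zero_iff hK hb]
      refine ⟨(m : F × K × K).1 * c, ?_⟩
      simp [Algebra.smul_def]
    rw [h1, zero_add]
    exact hm ⟨n', hn'⟩
  · have hx : ∀ s ∈ S, (s : F × K × K).1 = 0 → (s : F × K × K).2.1 = 0 := fun s hs hs1 =>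
      snd_fst_eq_zero_of_coneForm_eq_zero hK hb h (hS s hs) hs1
    by_cases hall : ∀ s ∈ S, (s : F × K × K).1 = 0
    · -- a totally singular subspace at infinity is mapped injectively by the functional on `y`
      refine finrank_le_one_of_linear_functional S (coordFunctional F b ∘ₗ LinearMap.snd F K K ∘ₗ
        LinearMap.snd F F (K × K) ∘ₗ H.subtype) fun s hs hs0 => ?_
      exact hmem s ((mem_span_vertex_iff _).2 ⟨hall s hs, hx s hs (hall s hs),
        (coordFunctional_eq_zero_iff hK hb _).1 hs0⟩)
    · push Not at hall
      obtain ⟨s₀, hs₀, ht₀⟩ := hall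
      refine finrank_le_one_of_linear_functional S (LinearMap.fst F F (K × K) ∘ₗ H.subtype)
        fun s hs hs1 => ?_
      replace hs1 : (s : F × K × K).1 = 0 := hs1
      refine hmem s ((mem_span_vertex_iff _).2 ⟨hs1, hx s hs hs1, ?_⟩)
      have h1 := (coneForm_eq_zero_iff hK hb α β _).1 (hS s₀ hs₀)
      have h2 := (coneForm_eq_zero_iff hK hb α β _).1 (hS _ (S.add_mem hs₀ hs))
      simp only [Submodule.subtype_apply, Prod.fst_add, Prod.snd_add, hs1,
        hx s hs hs1, add_zero, map_add] at h1 h2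
      rw [← conj_eq_self_iff]
      apply mul_left_cancel₀ ((map_ne_zero (algebraMap F K)).2 ht₀)
      linear_combination h2 - h1

theorem isBMUnital_ebertSet (hK : Module.finrank F K = 2) {a b α β : K}
    (hb : b ∉ Set.range (algebraMap F K)) (h : IsNormalization F a b α β) :
    IsBMUnital F (ebertSet F a b) := by
  obtain ⟨H, hH⟩ := Submodule.exists_isCompl (F ∙ ((0, 0, 1) : F × K × K))
  refine ⟨isUnital_ebertSet hK hb h, LinearEquiv.refl K _, (0, 1), (0, 0, 1), H,
    (coneForm F b α β).comp H.subtype, ?_, ?_, ?_, hH, isElliptic_coneForm hK hb h hH, ?_, ?_⟩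
  · exact fun h => one_ne_zero (congrArg Prod.snd h)
  · exact fun h => one_ne_zero (congrArg (fun m => m.2.2) h)
  · exact ⟨rfl, 1, (one_smul _ _).symm⟩
  · rw [quadricCone_coneForm hK hb α β hH]
    ext ⟨t, x, y⟩
    simp only [Set.mem_ofPred_eq, spreadLine, Prod.smul_mk, smul_eq_mul, mul_zero, mul_one,
      Prod.mk.injEq]
    constructor
    · rintro ⟨h1, h2⟩
      exact ⟨h2, y, snd_fst_eq_zero_of_coneForm_eq_zero hK hb h h1 h2, rfl⟩
    · rintro ⟨rfl, _, rfl, rfl⟩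
      refine ⟨?_, rfl⟩
      rw [coneForm_eq_zero_iff hK hb]
      simp
  · have hid : projectivity (LinearEquiv.refl K (Fin 3 → K)) = id := Projectivization.map_id
    rw [hid, Set.image_id, quadricCone_coneForm hK hb α β hH]
    ext p
    simp only [ebertSet, representedSet, Set.mem_insert_iff, Set.mem_ofPred_eq,
      coneForm_eq_zero_iff hK hb, map_one, one_mul, h.equation_iff hK]
    rw [or_comm]
    exact or_congr Iff.rfl
      ⟨fun hp => ⟨fun h => one_ne_zero (congrFun h 2), hp⟩, fun ⟨_, hp⟩ => hp⟩

end Cone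

/-! ### Parametrization of conics -/

section ConicParametrization

variable {K : Type*} [Field K]

theorem mk_mem_zeroSet_iff (Q : QuadraticForm K (Fin 3 → K)) (v : Fin 3 → K) (hv : v ≠ 0) :
    Projectivization.mk K v hv ∈ {p : PGPoint K | Q p.rep = 0} ↔ Q v = 0 := by
  obtain ⟨k, hk⟩ := Projectivization.exists_smul_eq_mk_rep K v hv
  rw [Set.mem_ofPred_eq, ← hk, Units.smul_def, QuadraticMap.map_smul, smul_eq_mul]
  simp

/-- The parametrization of a conic with the point `u`: in suitable coordinates with respect to a
basis `u`, `w`, `e` the quadratic form is `X Y + c Z ²`. -/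
theorem exists_conic_parametrization (Q : QuadraticForm K (Fin 3 → K))
    (hQ : ∀ v, v ≠ 0 → Q v = 0 → ∃ w, QuadraticMap.polar Q v w ≠ 0) {u : Fin 3 → K}
    (hu : u ≠ 0) (hQu : Q u = 0) :
    ∃ (w e : Fin 3 → K) (c : K), c ≠ 0 ∧ LinearIndependent K ![u, w, e] ∧
      ∀ t : K, Q ((-c * t ^ 2) • u + w + t • e) = 0 := by
  obtain ⟨w₀, hw₀⟩ := hQ u hu hQu
  set w₁ := (QuadraticMap.polar Q u w₀)⁻¹ • w₀ with hw₁
  have huw₁ : QuadraticMap.polar Q u w₁ = 1 := by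
    rw [hw₁, QuadraticMap.polar_smul_right, smul_eq_mul, inv_mul_cancel₀ hw₀]
  have huu : QuadraticMap.polar Q u u = 0 := by rw [QuadraticMap.polar_self, hQu, smul_zero]
  set w := (-Q w₁) • u + w₁ with hw
  have huw : QuadraticMap.polar Q u w = 1 := by
    rw [hw, QuadraticMap.polar_add_right, QuadraticMap.polar_smul_right, huu, smul_zero, huw₁,
      zero_add]
  have hQw : Q w = 0 := by
    rw [hw, QuadraticMap.map_add Q, QuadraticMap.map_smul, hQu, QuadraticMap.polar_smul_left, huw₁]
    simp
  have hww : QuadraticMap.polar Q w w = 0 := by rw [QuadraticMap.polar_self, hQw, smul_zero]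
  have hwu : QuadraticMap.polar Q w u = 1 := by rw [QuadraticMap.polar_comm, huw]
  obtain ⟨e, hek, he0⟩ := Submodule.exists_mem_ne_zero_of_ne_bot
    (LinearMap.ker_ne_bot_of_finrank_lt
      (f := (Q.polarBilin u).prod (Q.polarBilin w)) (by simp))
  rw [LinearMap.mem_ker, LinearMap.prod_apply] at hek
  have hue : QuadraticMap.polar Q u e = 0 := congrArg Prod.fst hek
  have hwe : QuadraticMap.polar Q w e = 0 := congrArg Prod.snd hek
  have hli : LinearIndependent K ![u, w, e] := by
    rw [Fintype.linearIndependent_iff]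
    intro g hg
    rw [Fin.sum_univ_three] at hg
    have hpol : ∀ x, g 0 * QuadraticMap.polar Q x u + g 1 * QuadraticMap.polar Q x w +
        g 2 * QuadraticMap.polar Q x e = 0 := by
      intro x
      have := congrArg (Q.polarBilin x) hg
      simpa using this
    have h1 : g 1 = 0 := by simpa [huu, huw, hue] using hpol u
    have h0 : g 0 = 0 := by simpa [hwu, hww, hwe] using hpol w
    have h2 : g 2 = 0 := by simpa [h0, h1, he0] using hg
    intro i
    fin_cases i <;> assumption
  refine ⟨w, e, Q e, ?_, hli, fun t => ?_⟩
  · intro hQe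
    obtain ⟨x, hx⟩ := hQ e he0 hQe
    apply hx
    let B := basisOfLinearIndependentOfCardEqFinrank hli (by simp)
    have h0 : Q.polarBilin e = 0 := by
      refine B.ext fun i => ?_
      have hB : B i = ![u, w, e] i := by simp [B]
      rw [hB]
      fin_cases i
      · simpa [QuadraticMap.polar_comm] using hue
      · simpa [QuadraticMap.polar_comm] using hwe
      · simp [hQe]
    exact LinearMap.congr_fun h0 x
  · rw [QuadraticMap.map_add Q, QuadraticMap.map_add Q, QuadraticMap.map_smul, QuadraticMap.map_smul,
      QuadraticMap.polar_add_left]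
    simp only [QuadraticMap.polar_smul_left, QuadraticMap.polar_smul_right, hQu, hQw, hue, hwe,
      huw, smul_eq_mul]
    ring

end ConicParametrization

/-! ### The straightened curve contains no conic -/

section CurveForm

/-- The form of degree `2 q`, for `q = n + 1`, whose zeros are the points of the straightened
curve, with arbitrary coefficients in a commutative ring. -/
def curveForm {R : Type*} [CommRing R] (n : ℕ) (c₁ c₂ c₃ z x y : R) : R :=
  (y * z) ^ (n + 1) - y * z ^ (2 * n + 1) + c₁ * (x * x) ^ (n + 1) - c₂ * (x ^ 2 * z ^ (2 * n)) -
    c₃ * (x ^ (n + 2) * z ^ n)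

theorem map_curveForm {R S : Type*} [CommRing R] [CommRing S] (f : R →+* S) (n : ℕ)
    (c₁ c₂ c₃ z x y : R) : f (curveForm n c₁ c₂ c₃ z x y) =
      curveForm n (f c₁) (f c₂) (f c₃) (f z) (f x) (f y) := by
  simp [curveForm]

/-- On quadratic polynomials the form has degree at most `4 q`, and the coefficient of degree `4 q`
is the value of the form at the quadratic coefficients. -/
theorem natDegree_curveForm_le_and_coeff {R : Type*} [CommRing R] (n : ℕ) (c₁ c₂ c₃ : R)
    {z x y : Polynomial R} (hz : z.natDegree ≤ 2) (hx : x.natDegree ≤ 2) (hy : y.natDegree ≤ 2) :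
    (curveForm n (.C c₁) (.C c₂) (.C c₃) z x y).natDegree ≤ 4 * (n + 1) ∧
    (curveForm n (.C c₁) (.C c₂) (.C c₃) z x y).coeff (4 * (n + 1)) =
      curveForm n c₁ c₂ c₃ (z.coeff 2) (x.coeff 2) (y.coeff 2) := by
  -- the degree bound and the coefficient at the bound are computed together
  have hmul : ∀ {f g : Polynomial R} {M N : ℕ} {c d : R}, f.natDegree ≤ M ∧ f.coeff M = c →
      g.natDegree ≤ N ∧ g.coeff N = d →
      (f * g).natDegree ≤ M + N ∧ (f * g).coeff (M + N) = c * d := by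
    rintro f g M N _ _ ⟨hf, rfl⟩ ⟨hg, rfl⟩
    exact ⟨Polynomial.natDegree_mul_le_of_le hf hg, Polynomial.coeff_mul_add_eq_of_natDegree_le hf hg⟩
  have hpow : ∀ {f : Polynomial R} {M : ℕ} {c : R} (m : ℕ), f.natDegree ≤ M ∧ f.coeff M = c →
      (f ^ m).natDegree ≤ m * M ∧ (f ^ m).coeff (m * M) = c ^ m := by
    rintro f M _ m ⟨hf, rfl⟩
    exact ⟨Polynomial.natDegree_pow_le_of_le m hf, Polynomial.coeff_pow_of_natDegree_le hf⟩
  have hC : ∀ c : R, (Polynomial.C c).natDegree ≤ 0 ∧ (Polynomial.C c).coeff 0 = c := fun c =>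
    ⟨(Polynomial.natDegree_C c).le, Polynomial.coeff_C_zero⟩
  have hz' := And.intro hz (Eq.refl (z.coeff 2))
  have hx' := And.intro hx (Eq.refl (x.coeff 2))
  have hy' := And.intro hy (Eq.refl (y.coeff 2))
  have h1 := hpow (n + 1) (hmul hy' hz')
  have h2 := hmul hy' (hpow (2 * n + 1) hz')
  have h3 := hmul (hC c₁) (hpow (n + 1) (hmul hx' hx'))
  have h4 := hmul (hC c₂) (hmul (hpow 2 hx') (hpow (2 * n) hz'))
  have h5 := hmul (hC c₃) (hmul (hpow (n + 2) hx') (hpow n hz'))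
  rw [show (n + 1) * (2 + 2) = 4 * (n + 1) by ring] at h1
  rw [show 2 + (2 * n + 1) * 2 = 4 * (n + 1) by ring] at h2
  rw [show 0 + (n + 1) * (2 + 2) = 4 * (n + 1) by ring] at h3
  rw [show 0 + (2 * 2 + 2 * n * 2) = 4 * (n + 1) by ring] at h4
  rw [show 0 + ((n + 2) * 2 + n * 2) = 4 * (n + 1) by ring] at h5
  constructor
  · exact (Polynomial.natDegree_sub_le_of_le (Polynomial.natDegree_sub_le_of_le
      (Polynomial.natDegree_add_le_of_degree_le (Polynomial.natDegree_sub_le_of_le h1.1 h2.1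
        |>.trans (max_self _).le) h3.1) h4.1 |>.trans (max_self _).le) h5.1).trans (max_self _).le
  · simp only [curveForm, Polynomial.coeff_sub, Polynomial.coeff_add, h1.2, h2.2, h3.2, h4.2, h5.2]

variable {F K : Type*} [Field F] [Fintype F] [Field K] [Algebra F K]

theorem eq_pointAtInfinity_of_mem_ebertSet {a b : K} {v : Fin 3 → K} {hv : v ≠ 0}
    (h : Projectivization.mk K v hv ∈ ebertSet F a b) (h0 : v 0 = 0) :
    Projectivization.mk K v hv = pointAtInfinity none := by
  rcases h with h | ⟨x, y, -, h⟩
  · exact h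
  · have h1 := (mk_mem_coordLine ![1, 0, 0] v hv).2 (by simp [dotProduct, Fin.sum_univ_three, h0])
    rw [h, affinePoint_mem_coordLine] at h1
    simp at h1

theorem curveForm_eq_zero_of_mem_ebertSet {n : ℕ} (hn : Fintype.card F = n + 1) {a b : K}
    {v : Fin 3 → K} {hv : v ≠ 0} (h : Projectivization.mk K v hv ∈ ebertSet F a b) :
    curveForm n (a ^ (n + 1)) a (b ^ (n + 1) - b) (v 0) (v 1) (v 2) = 0 := by
  by_cases h0 : v 0 = 0
  · have h1 := mk_mem_coordLine ![0, 1, 0] v hv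
    rw [eq_pointAtInfinity_of_mem_ebertSet h h0, pointAtInfinity_none_mem_coordLine] at h1
    have h1' : v 1 = 0 := by simpa [dotProduct, Fin.sum_univ_three] using h1
    simp [curveForm, h0, h1']
  · have hmk : Projectivization.mk K v hv = affinePoint (v 1 / v 0) (v 2 / v 0) := by
      rw [affinePoint, Projectivization.mk_eq_mk_iff']
      refine ⟨v 0, ?_⟩
      ext i
      fin_cases i <;> simp <;> field_simp
    rw [hmk, affinePoint_mem_ebertSet, EbertEquation] at h
    obtain ⟨x, hx⟩ : ∃ x, x = v 1 / v 0 := ⟨_, rfl⟩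
    obtain ⟨y, hy⟩ : ∃ y, y = v 2 / v 0 := ⟨_, rfl⟩
    have hx' : v 1 = x * v 0 := by rw [hx, div_mul_cancel₀ _ h0]
    have hy' : v 2 = y * v 0 := by rw [hy, div_mul_cancel₀ _ h0]
    rw [← hx, ← hy] at h
    simp only [conj_apply, hn] at h
    rw [curveForm, hx', hy']
    linear_combination (v 0) ^ (2 * n + 2) * h

/-- The polynomials which parametrize a conic contained in the curve satisfy its equation
identically: the equation has degree at most `4 q` in the parameter and holds for all `q ²`
elements of `K`, and also at infinity. -/
theorem curveForm_parametrization_eq_zero (hK : Module.finrank F K = 2) {n : ℕ}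
    (hn : Fintype.card F = n + 1) (hn3 : 3 ≤ n) {a b : K} (p : Fin 3 → Polynomial K)
    (hdeg : ∀ i, (p i).natDegree ≤ 2)
    (heval : ∀ t : K, curveForm n (a ^ (n + 1)) a (b ^ (n + 1) - b) ((p 0).eval t) ((p 1).eval t)
      ((p 2).eval t) = 0)
    (hinf : curveForm n (a ^ (n + 1)) a (b ^ (n + 1) - b) ((p 0).coeff 2) ((p 1).coeff 2)
      ((p 2).coeff 2) = 0) :
    curveForm n (.C (a ^ (n + 1))) (.C a) (.C (b ^ (n + 1) - b)) (p 0) (p 1) (p 2) = 0 := by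
  have := finite_of_finrank_eq_two hK
  have := Fintype.ofFinite K
  set G := curveForm n (.C (a ^ (n + 1))) (.C a) (.C (b ^ (n + 1) - b)) (p 0) (p 1) (p 2) with hG
  obtain ⟨h1, h2⟩ := natDegree_curveForm_le_and_coeff n (a ^ (n + 1)) a (b ^ (n + 1) - b)
    (hdeg 0) (hdeg 1) (hdeg 2)
  rw [hinf, ← hG] at h2
  rw [← hG] at h1
  have h3 : G.natDegree < 4 * (n + 1) := by
    refine lt_of_le_of_ne h1 fun h => ?_
    rw [← h, ← Polynomial.leadingCoeff, Polynomial.leadingCoeff_eq_zero] at h2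
    rw [h2, Polynomial.natDegree_zero] at h
    omega
  refine Polynomial.eq_zero_of_natDegree_lt_card_of_eval_eq_zero G
    (f := (id : K → K)) Function.injective_id (fun t => ?_) ?_
  · rw [hG, id, ← Polynomial.coe_evalRingHom, map_curveForm]
    simpa using heval t
  · rw [← Nat.card_eq_fintype_card, natCard_eq_sq hK, hn]
    nlinarith

/-- If the first coordinate of a parametrization satisfying the equation of the curve has no zero,
not even at infinity, it is irreducible and hence divides the second coordinate. -/
theorem exists_eq_C_mul_of_eval_ne_zero {n : ℕ} (hn : n ≠ 0) {c₁ c₂ c₃ : K} (hc₁ : c₁ ≠ 0)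
    {p : Fin 3 → Polynomial K} (hdeg : ∀ i, (p i).natDegree ≤ 2)
    (h : curveForm n (.C c₁) (.C c₂) (.C c₃) (p 0) (p 1) (p 2) = 0)
    (h0 : (p 0).coeff 2 ≠ 0) (hroot : ∀ t, (p 0).eval t ≠ 0) :
    ∃ k : K, p 1 = .C k * p 0 := by
  have hdeg0 : (p 0).natDegree = 2 :=
    le_antisymm (hdeg 0) (Polynomial.le_natDegree_of_ne_zero h0)
  have hp0 : p 0 ≠ 0 := by
    intro hp
    rw [hp] at h0
    simp at h0
  have hirr : Irreducible (p 0) := by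
    rw [Polynomial.irreducible_iff_roots_eq_zero_of_degree_le_three (by omega) (by omega)]
    refine Multiset.eq_zero_of_forall_notMem fun t ht => hroot t ?_
    exact (Polynomial.mem_roots'.1 ht).2
  have hdvd : p 0 ∣ .C c₁ * (p 1 * p 1) ^ (n + 1) := by
    obtain ⟨n, rfl⟩ : ∃ m, n = m + 1 := Nat.exists_eq_succ_of_ne_zero hn
    have h' : .C c₁ * (p 1 * p 1) ^ (n + 1 + 1) = p 0 * (-(p 2 * (p 2 * p 0) ^ (n + 1)) +
        p 2 * p 0 ^ (2 * n + 2) + .C c₂ * (p 1 ^ 2 * p 0 ^ (2 * n + 1)) +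
        .C c₃ * (p 1 ^ (n + 1 + 2) * p 0 ^ n)) := by
      rw [curveForm] at h
      linear_combination h
    exact ⟨_, h'⟩
  have hprime := hirr.prime
  have hdvd1 : p 0 ∣ p 1 := by
    rcases hprime.dvd_or_dvd hdvd with hd | hd
    · exact absurd (isUnit_of_dvd_unit hd (Polynomial.isUnit_C.2 hc₁.isUnit)) hirr.not_isUnit
    · rcases hprime.dvd_or_dvd (hprime.dvd_of_dvd_pow hd) with hd | hd <;> exact hd
  obtain ⟨r, hr⟩ := hdvd1
  by_cases hr0 : r = 0
  · exact ⟨0, by rw [hr, hr0]; simp⟩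
  · have hrdeg : r.natDegree = 0 := by
      have := hdeg 1
      rw [hr, Polynomial.natDegree_mul hp0 hr0, hdeg0] at this
      omega
    rw [Polynomial.eq_C_of_natDegree_eq_zero hrdeg] at hr
    exact ⟨_, hr.trans (mul_comm _ _)⟩

/-- A parabola `(w₀, e₁ t + w₁, p₂(t))` cannot satisfy the equation of the curve, since `c₃` would
be the only contribution to the coefficient of `t ^ (q + 1)`. -/
theorem false_of_parabola_parametrization {n : ℕ} (hn : Fintype.card F = n + 1) (hn2 : 2 ≤ n)
    {c₁ c₂ c₃ w₀ e₁ w₁ r₀ r₁ r₂ : K} (hc₃ : c₃ ≠ 0) (hw₀ : w₀ ≠ 0) (he₁ : e₁ ≠ 0)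
    (h : curveForm n (.C c₁) (.C c₂) (.C c₃) (.C w₀) (.C e₁ * .X + .C w₁)
      (.C r₂ * .X ^ 2 + .C r₁ * .X + .C r₀ : Polynomial K) = 0) : False := by
  have hadd : ∀ f g : Polynomial K, (f + g) ^ (n + 1) = f ^ (n + 1) + g ^ (n + 1) := by
    intro f g
    rw [← hn]
    exact map_add (FiniteField.frobeniusAlgHom F (Polynomial K)) f g
  have hx : (Polynomial.C e₁ * .X + .C w₁) ^ (n + 1) =
      Polynomial.C e₁ ^ (n + 1) * .X ^ (n + 1) + .C w₁ ^ (n + 1) := by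
    rw [hadd, mul_pow]
  have hy : (Polynomial.C r₂ * .X ^ 2 + .C r₁ * .X + .C r₀) ^ (n + 1) =
      Polynomial.C r₂ ^ (n + 1) * (.X ^ 2) ^ (n + 1) + .C r₁ ^ (n + 1) * .X ^ (n + 1) +
        .C r₀ ^ (n + 1) := by
    rw [hadd, hadd, mul_pow, mul_pow]
  have hexpand : (.C (r₂ ^ (n + 1) * w₀ ^ (n + 1) + c₁ * (e₁ ^ (n + 1)) ^ 2) * .X ^ (2 * n + 2) +
      .C (r₁ ^ (n + 1) * w₀ ^ (n + 1) + 2 * c₁ * e₁ ^ (n + 1) * w₁ ^ (n + 1) -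
        c₃ * w₀ ^ n * e₁ ^ (n + 1) * w₁) * .X ^ (n + 1) +
      .C (r₀ ^ (n + 1) * w₀ ^ (n + 1) - r₀ * w₀ ^ (2 * n + 1) + c₁ * (w₁ ^ (n + 1)) ^ 2 -
        c₂ * w₁ ^ 2 * w₀ ^ (2 * n) - c₃ * w₀ ^ n * w₁ ^ (n + 1) * w₁) +
      .C (-r₂ * w₀ ^ (2 * n + 1) - c₂ * e₁ ^ 2 * w₀ ^ (2 * n)) * .X ^ 2 +
      .C (-r₁ * w₀ ^ (2 * n + 1) - 2 * c₂ * e₁ * w₁ * w₀ ^ (2 * n) -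
        c₃ * w₀ ^ n * w₁ ^ (n + 1) * e₁) * .X -
      .C (c₃ * e₁ ^ (n + 2) * w₀ ^ n) * .X ^ (n + 2) : Polynomial K) = 0 := by
    rw [← h, curveForm, mul_pow, mul_pow, pow_succ (_ + _) (n + 1), hx, hy]
    simp only [map_add, map_sub, map_mul, map_pow, map_neg, map_ofNat]
    ring
  have hcoeff := congrArg (fun f => Polynomial.coeff f (n + 2)) hexpand
  simp only [Polynomial.coeff_sub, Polynomial.coeff_add, Polynomial.coeff_C_mul,
    Polynomial.coeff_X_pow, Polynomial.coeff_C, Polynomial.coeff_X, Polynomial.coeff_zero] at hcoeff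
  rw [if_neg (by omega), if_neg (by omega), if_neg (by omega), if_neg (by omega),
    if_neg (by omega), if_pos True.intro] at hcoeff
  refine mul_ne_zero (mul_ne_zero hc₃ (pow_ne_zero (n + 2) he₁)) (pow_ne_zero n hw₀) ?_
  linear_combination -hcoeff

/-- A conic contained in the curve gives a contradiction. If it contains the point at infinity, it
is a parabola with the vertical direction; otherwise it has no points on the line at infinity. -/
theorem not_isConic_subset_ebertSet (hK : Module.finrank F K = 2) {a b : K} (ha : a ≠ 0)
    (hb : b ∉ Set.range (algebraMap F K)) (hq : 4 ≤ Fintype.card F) {C : Set (PGPoint K)}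
    (hC : IsConic C) {P : PGPoint K} (hP : P ∈ C) : ¬ C ⊆ ebertSet F a b := by
  intro hsub
  obtain ⟨n, hn⟩ : ∃ n, Fintype.card F = n + 1 := Nat.exists_eq_succ_of_ne_zero (by omega)
  obtain ⟨Q, hQ, rfl⟩ := hC
  -- if the conic contains the point `(0, 0, 1)`, this point is given the parameter infinity
  obtain ⟨u, hu, hQu, hcase⟩ : ∃ u : Fin 3 → K, u ≠ 0 ∧ Q u = 0 ∧ ((u 0 = 0 ∧ u 1 = 0) ∨
      pointAtInfinity none ∉ {p : PGPoint K | Q p.rep = 0}) := by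
    by_cases hinf : pointAtInfinity none ∈ {p : PGPoint K | Q p.rep = 0}
    · exact ⟨![0, 0, 1], fun h => one_ne_zero (congrFun h 2),
        (mk_mem_zeroSet_iff Q _ _).1 hinf, Or.inl ⟨rfl, rfl⟩⟩
    · exact ⟨P.rep, P.rep_nonzero, hP, Or.inr hinf⟩
  obtain ⟨w, e, c, hc, hli, hpar⟩ := exists_conic_parametrization Q hQ hu hQu
  have hzero : ∀ v, v ≠ 0 → Q v = 0 →
      curveForm n (a ^ (n + 1)) a (b ^ (n + 1) - b) (v 0) (v 1) (v 2) = 0 := fun v hv hQv =>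
    curveForm_eq_zero_of_mem_ebertSet hn (hsub ((mk_mem_zeroSet_iff Q v hv).2 hQv))
  have hdet : Matrix.det (Matrix.of ![u, w, e]) ≠ 0 := by
    rw [← isUnit_iff_ne_zero, ← Matrix.isUnit_iff_isUnit_det]
    exact Matrix.linearIndependent_rows_iff_isUnit.1 hli
  rw [Matrix.det_fin_three] at hdet
  simp only [Matrix.of_apply, Matrix.cons_val] at hdet
  have hne : ∀ s t : K, s • u + w + t • e ≠ 0 := by
    intro s t h
    have h0 := congrFun h 0
    have h1 := congrFun h 1
    have h2 := congrFun h 2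
    simp only [Pi.add_apply, Pi.smul_apply, smul_eq_mul, Pi.zero_apply] at h0 h1 h2
    apply hdet
    linear_combination (u 2 * e 1 - u 1 * e 2) * h0 + (u 0 * e 2 - u 2 * e 0) * h1 +
      (u 1 * e 0 - u 0 * e 1) * h2
  obtain ⟨p, hp⟩ : ∃ p : Fin 3 → Polynomial K,
      ∀ i, p i = .C (-c * u i) * .X ^ 2 + .C (e i) * .X + .C (w i) := ⟨_, fun _ => rfl⟩
  have hpeval : ∀ i t, (p i).eval t = ((-c * t ^ 2) • u + w + t • e) i := by
    intro i t
    simp only [hp, Polynomial.eval_add, Polynomial.eval_mul, Polynomial.eval_pow,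
      Polynomial.eval_C, Polynomial.eval_X, Pi.add_apply, Pi.smul_apply, smul_eq_mul]
    ring
  have hp2 : ∀ i, (p i).coeff 2 = ((-c) • u) i := by
    intro i
    simp only [hp, Polynomial.coeff_add, Polynomial.coeff_C_mul, Polynomial.coeff_X_pow,
      Polynomial.coeff_X, Polynomial.coeff_C, Pi.smul_apply, smul_eq_mul]
    norm_num
  have hp1 : ∀ i, (p i).coeff 1 = e i := by
    intro i
    simp only [hp, Polynomial.coeff_add, Polynomial.coeff_C_mul, Polynomial.coeff_X_pow,
      Polynomial.coeff_X, Polynomial.coeff_C]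
    norm_num
  have hp0 : ∀ i, (p i).coeff 0 = w i := by
    intro i
    simp only [hp, Polynomial.coeff_add, Polynomial.coeff_C_mul, Polynomial.coeff_X_pow,
      Polynomial.coeff_X, Polynomial.coeff_C]
    norm_num
  have hdeg : ∀ i, (p i).natDegree ≤ 2 := fun i => hp i ▸ Polynomial.natDegree_quadratic_le
  have hG := curveForm_parametrization_eq_zero (F := F) hK hn (by omega) (a := a) (b := b) p hdeg
    (fun t => by simpa only [hpeval] using hzero _ (hne _ t) (hpar t))
    (by
      simpa only [hp2] using hzero ((-c) • u) (smul_ne_zero (neg_ne_zero.2 hc) hu)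
        (by rw [QuadraticMap.map_smul, hQu, smul_zero]))
  have hδ : b ^ (n + 1) - b ≠ 0 := by
    rw [← hn, ← conj_apply]
    exact conj_sub_self_ne_zero hb
  rcases hcase with ⟨hu0, hu1⟩ | hinf
  · by_cases he0 : e 0 = 0
    · rw [hp 0, hp 1, hp 2, hu0, hu1, he0, mul_zero, map_zero, zero_mul, zero_mul, zero_add,
        zero_add, zero_add] at hG
      refine false_of_parabola_parametrization (F := F) (w₀ := w 0) (e₁ := e 1) (w₁ := w 1)
        (r₀ := w 2) (r₁ := e 2) (r₂ := -c * u 2) hn (by omega) hδ ?_ ?_ hG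
      · intro h
        apply hdet
        rw [hu0, hu1, he0, h]
        ring
      · intro h
        apply hdet
        rw [hu0, hu1, he0, h]
        ring
    -- the parameter `r` would give a second point of the curve on the line at infinity
    · obtain ⟨r, hr⟩ : ∃ r, r * e 0 = -w 0 := ⟨_, div_mul_cancel₀ _ he0⟩
      have h1 := hzero _ (hne _ _) (hpar r)
      have hv0 : ((-c * r ^ 2) • u + w + r • e) 0 = 0 := by
        simp only [Pi.add_apply, Pi.smul_apply, smul_eq_mul, hu0]
        linear_combination hr
      have hn0 : n ≠ 0 := by omega
      have hv1 : ((-c * r ^ 2) • u + w + r • e) 1 = 0 := by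
        rw [hv0] at h1
        simpa [curveForm, hn0, ha] using h1
      simp only [Pi.add_apply, Pi.smul_apply, smul_eq_mul, hu1] at hv1
      apply hdet
      rw [hu0, hu1]
      linear_combination (u 2 * e 1) * hr - (u 2 * e 0) * hv1
  -- no point at infinity: the first two coordinates are proportional, so the conic lies in a line
  · have hoff : ∀ v, v ≠ 0 → Q v = 0 → v 0 ≠ 0 := by
      intro v hv hQv h0
      have hm := (mk_mem_zeroSet_iff Q v hv).2 hQv
      rw [eq_pointAtInfinity_of_mem_ebertSet (hsub hm) h0] at hm
      exact hinf hm
    obtain ⟨k, hk⟩ := exists_eq_C_mul_of_eval_ne_zero (by omega) (pow_ne_zero (n + 1) ha)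
      hdeg hG (by rw [hp2]; exact mul_ne_zero (neg_ne_zero.2 hc) (hoff u hu hQu))
      (fun t => by rw [hpeval]; exact hoff _ (hne _ t) (hpar t))
    have hcoeff : ∀ m, (p 1).coeff m = k * (p 0).coeff m := by
      intro m
      rw [hk, Polynomial.coeff_C_mul]
    have k0 : w 1 = k * w 0 := by simpa only [hp0] using hcoeff 0
    have k1 : e 1 = k * e 0 := by simpa only [hp1] using hcoeff 1
    have k2 : u 1 = k * u 0 := by
      have := hcoeff 2
      rw [hp2, hp2, Pi.smul_apply, Pi.smul_apply, smul_eq_mul, smul_eq_mul] at this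
      apply mul_left_cancel₀ (neg_ne_zero.2 hc)
      linear_combination this
    apply hdet
    rw [k0, k1, k2]
    ring

end CurveForm

end NonStandardUnital

end

/-! ### The Hermitian curve in the closed plane of parabolas -/

/-- The isomorphism `e` is the one that gives the point `(x, y)` of the plane of parabolas the
affine coordinates `(x, y - a x²)`; it is determined by its values on the affine points. -/
theorem theorem3p9 {F K : Type*} [Field F] [Fintype F] [Field K] [Algebra F K]
    (hK : Module.finrank F K = 2) (a b : K) (ha : a ≠ 0)
    (hb : b ∉ Set.range (algebraMap F K))
    (hE : NonStandardUnital.EbertCondition F a b) :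
    ∃ e : NonStandardUnital.IncidenceIso
        (NonStandardUnital.projectiveClosure (NonStandardUnital.parabolaPlane a))
        (NonStandardUnital.PG2 K),
      (∀ x y : K, e.toEquiv (Sum.inl (x, y)) =
        NonStandardUnital.affinePoint x (y - a * x ^ 2)) ∧
      NonStandardUnital.IsBMUnital F
        (e.toEquiv '' NonStandardUnital.completedCurve (Fintype.card F) a b) ∧
      ¬ NonStandardUnital.IsHSzUnital F
        (e.toEquiv '' NonStandardUnital.completedCurve (Fintype.card F) a b) := by
  have himage : (NonStandardUnital.straightenIso a).toEquiv ''
      NonStandardUnital.completedCurve (Fintype.card F) a b =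
        NonStandardUnital.ebertSet F a b := NonStandardUnital.image_completedCurve F a b
  refine ⟨NonStandardUnital.straightenIso a, NonStandardUnital.straightenEquiv_inl a, ?_, ?_⟩
  · obtain ⟨α, β, h⟩ := NonStandardUnital.exists_isNormalization hK ha hb hE
    rw [himage]
    exact NonStandardUnital.isBMUnital_ebertSet hK hb h
  · rw [himage]
    rintro ⟨-, P, C, hC, hU⟩
    -- a single conic already gives the contradiction
    have i : Fin (Fintype.card F) := ⟨0, Fintype.card_pos⟩
    refine NonStandardUnital.not_isConic_subset_ebertSet hK ha hb
      (NonStandardUnital.four_le_card hK ha hb hE) (hC i).1 (hC i).2 ?_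
    rw [hU]
    exact Set.subset_iUnion C i
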